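/- Let $(R,\mathfrak m)$ be a (commutative, Noetherian) Gorenstein local ring with $\dim R=1$, that is, $R$ has finite injective dimension as a module over itself. For a finitely generated $R$-module $M$ write $\nu_R(M)$ for its minimal number of generators, $M^*=\operatorname{Hom}_R(M,R)$, and $\operatorname{tr}_R(M)$ for the image of the evaluation map $M^*\otimes_R M\to R$, $f\otimes x\mapsto f(x)$. Let $e(R)=\lim_{n\to\infty}\operatorname{length}_R(R/\mathfrak m^n)/n$ be the multiplicity of $R$. Let $I$ be an ideal of $R$ that contains a regular element (a non-zero-divisor) and such that $I\otimes_R I^*$ is torsionfree, i.e. no regular element of $R$ kills a nonzero element of it. Then the limit defining $e(R)$ exists, the maximum in $$\delta := e(R)-\max\{\nu_R(J)\mid J \text{ an ideal of } R,\ J\supseteq \operatorname{tr}_R(I)\}$$ is attained, and the following hold. When $I$ is not principal: 1. $\delta\ge \nu_R(I)$ and $\delta\ge\nu_R(I^*)$; 2. $\delta\ge \bigl(e(R)-\nu_R(I^*)\bigr)\,\nu_R(I)^{-1}$; 3. $\delta^2\ge e(R)-\delta\ge \nu_R(I)\,\nu_R(I^*)\ge 6$. Moreover, the equality $\delta^2=e(R)-\delta$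 holds if and only if $\delta=\nu_R(I)=\nu_R(I^*)$. -/

import Mathlib

open scoped TensorProduct

namespace OneDimGor

noncomputable section

universe u v

/-- `ν_R(M)`: the minimal number of generators of the `R`-module `M`. -/
def nu (R : Type u) [CommRing R] (M : Type v) [AddCommGroup M] [Module R M] : ℕ :=
  (⊤ : Submodule R M).spanFinrank

/-- `tr_R(M)`: the image of the evaluation map `M^* ⊗ M → R`, `f ⊗ x ↦ f x`. -/
def trace (R : Type u) [CommRing R] (M : Type v) [AddCommGroup M] [Module R M] : Ideal R :=
  LinearMap.range (contractLeft R M)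

/-- The normalised Hilbert–Samuel function `n ↦ d! · length (R / 𝔪 ^ n) / n ^ d`, where
`d = dim R`. -/
def normalizedLength (R : Type u) [CommRing R] [IsLocalRing R] (n : ℕ) : ℝ :=
  let d : ℕ := ((ringKrullDim R).unbotD 0).toNat
  (d.factorial : ℝ) *
    ((Module.length R (R ⧸ IsLocalRing.maximalIdeal R ^ n)).toNat : ℝ) / (n : ℝ) ^ d

/-- The multiplicity `e(R)` of a local ring: the limit of `d! · length (R / 𝔪 ^ n) / n ^ d`. -/
def mult (R : Type u) [CommRing R] [IsLocalRing R] : ℝ :=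
  Filter.limUnder Filter.atTop (normalizedLength R)

/-- A (Noetherian local) ring is Gorenstein if it has finite injective dimension as a module
over itself. -/
def IsGorenstein (R : Type u) [CommRing R] : Prop :=
  CategoryTheory.injectiveDimension (ModuleCat.of.{u} R R) ≠ ⊤

/-- The numbers of generators of the ideals that contain the trace of `I`. -/
def nuAboveTrace {R : Type u} [CommRing R] (I : Ideal R) : Set ℕ :=
  {n | ∃ J : Ideal R, trace R I ≤ J ∧ nu R J = n}

/-- `δ = e(R) - max {ν_R(J) | J ⊇ tr_R(I)}`. -/
def delta {R : Type u} [CommRing R] [IsLocalRing R] (I : Ideal R) : ℝ :=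
  mult R - ((sSup (nuAboveTrace I) : ℕ) : ℝ)

end

end OneDimGor

/-!
Evaluation at a regular `a ∈ I` identifies `I^*` with the ideal `K = (a) : I`. Over the
Gorenstein ring `R` the ideal `I` is reflexive, so `I = (a) : K` as well. After passing to `R(X)`,
there is a regular `f ∈ 𝔪` with `f 𝔪 ^ n = 𝔪 ^ (n + 1)` for large `n`, and then
`length (N / f N) = e` for every ideal `N` of finite colength. For `J ⊇ tr I` one has
`I K ⊆ a J`, so multiplication by the `ν(I)` generators of `I`, followed by division by `a`, embeds
`𝔪 K / f K` into the `ν(I)`-th power of `𝔪 J / f J`. Counting lengths,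
`e - ν(K) ≤ ν(I) (e - ν(J))`, and the same holds with `I` and `K` exchanged.

Torsionfreeness makes `I ⊗ I^* → tr I` an isomorphism, so `ν(tr I) = ν(I) ν(I^*)`; everything
except the bound `6` is then arithmetic. For that bound, if `ν(I) = ν(I^*) = 2`, comparing lengths
in the Koszul relations of `I` forces the inclusion `I → R` into `I I^*`, so that `tr I = R` would
need four generators.
-/

namespace OneDimGor

open IsLocalRing Polynomial Filter

universe u

section GorensteinReflexive

open CategoryTheory Abelian

lemma ext_subsingleton_left {C : Type*} [Category C] [Abelian C] [HasExt C] {S : ShortComplex C}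
    (hS : S.ShortExact) (Y : C) (n : ℕ) (h₂ : Subsingleton (Ext S.X₂ Y n))
    (h₃ : Subsingleton (Ext S.X₃ Y (n + 1))) : Subsingleton (Ext S.X₁ Y n) := by
  refine subsingleton_of_forall_eq 0 fun x ↦ ?_
  obtain ⟨y, rfl⟩ := Ext.contravariant_sequence_exact₁ hS Y x (add_comm 1 n) (h₃.elim _ _)
  rw [h₂.elim y 0, Ext.comp_zero]

lemma ext_subsingleton_middle {C : Type*} [Category C] [Abelian C] [HasExt C]
    {S : ShortComplex C} (hS : S.ShortExact) (Y : C) (n : ℕ) (h₁ : Subsingleton (Ext S.X₁ Y n))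
    (h₃ : Subsingleton (Ext S.X₃ Y n)) : Subsingleton (Ext S.X₂ Y n) := by
  refine subsingleton_of_forall_eq 0 fun x ↦ ?_
  obtain ⟨y, rfl⟩ := Ext.contravariant_sequence_exact₂ hS Y x (h₁.elim _ _)
  rw [h₃.elim y 0, Ext.comp_zero]

lemma ext_subsingleton_right {C : Type*} [Category C] [Abelian C] [HasExt C]
    {S : ShortComplex C} (hS : S.ShortExact) (Y : C) (n : ℕ) (h₁ : Subsingleton (Ext S.X₁ Y n))
    (h₂ : Subsingleton (Ext S.X₂ Y (n + 1))) : Subsingleton (Ext S.X₃ Y (n + 1)) := by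
  refine subsingleton_of_forall_eq 0 fun x ↦ ?_
  obtain ⟨y, rfl⟩ := Ext.contravariant_sequence_exact₃ hS Y x (h₂.elim _ _) (add_comm 1 n)
  rw [h₁.elim y 0, Ext.comp_zero]

variable {R : Type u} [CommRing R]

lemma shortExact_of_exact {M N P : Type u} [AddCommGroup M] [Module R M] [AddCommGroup N]
    [Module R N] [AddCommGroup P] [Module R P] {f : M →ₗ[R] N} {g : N →ₗ[R] P}
    (hf : Function.Injective f) (hg : Function.Surjective g) (h : Function.Exact f g) :
    (ModuleCat.shortComplexOfCompEqZero f g h.linearMap_comp_eq_zero).ShortExact where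
  exact := (ShortComplex.ShortExact.moduleCat_exact_iff_function_exact _).mpr h
  mono_f := (ModuleCat.mono_iff_injective _).mpr hf
  epi_g := (ModuleCat.epi_iff_surjective _).mpr hg

lemma shortExact_of_injective {M N : Type u} [AddCommGroup M] [Module R M] [AddCommGroup N]
    [Module R N] {f : M →ₗ[R] N} (hf : Function.Injective f) :
    (ModuleCat.shortComplexOfCompEqZero f (LinearMap.range f).mkQ
      (LinearMap.exact_map_mkQ_range f).linearMap_comp_eq_zero).ShortExact :=
  shortExact_of_exact hf (Submodule.mkQ_surjective _) (LinearMap.exact_map_mkQ_range f)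

lemma mulLeft_injective_of_mem_nonZeroDivisors {a : R} (ha : a ∈ nonZeroDivisors R) :
    Function.Injective (LinearMap.mulLeft R a) :=
  fun _ _ h ↦ (mul_cancel_left_mem_nonZeroDivisors ha).1 h

lemma mkQ_span_singleton_eq_zero_iff {a z : R} : (Ideal.span {a}).mkQ z = 0 ↔ a ∣ z := by
  rw [Submodule.mkQ_apply, Submodule.Quotient.mk_eq_zero, Ideal.mem_span_singleton]

lemma exact_mulLeft_mkQ (a : R) :
    Function.Exact (LinearMap.mulLeft R a) (Ideal.span {a}).mkQ := by
  intro z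
  rw [mkQ_span_singleton_eq_zero_iff]
  simp [dvd_def, eq_comm]

lemma shortExact_mulLeft_mkQ {a : R} (ha : a ∈ nonZeroDivisors R) :
    (ModuleCat.shortComplexOfCompEqZero (LinearMap.mulLeft R a) (Ideal.span {a}).mkQ
      (exact_mulLeft_mkQ a).linearMap_comp_eq_zero).ShortExact :=
  shortExact_of_exact (mulLeft_injective_of_mem_nonZeroDivisors ha)
    (Submodule.mkQ_surjective _) (exact_mulLeft_mkQ a)

lemma ext_ring_subsingleton (Y : ModuleCat.{u} R) (n : ℕ) :
    Subsingleton (Ext (ModuleCat.of R R) Y (n + 1)) :=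
  Ext.subsingleton_of_projective _ _ _

lemma ext_quotient_span_singleton_subsingleton {a : R} (ha : a ∈ nonZeroDivisors R)
    (Y : ModuleCat.{u} R) (n : ℕ) :
    Subsingleton (Ext (ModuleCat.of R (R ⧸ Ideal.span {a})) Y (n + 2)) :=
  ext_subsingleton_right (shortExact_mulLeft_mkQ ha) Y (n + 1) (ext_ring_subsingleton Y n)
    (ext_ring_subsingleton Y (n + 1))

lemma exists_injective_of_mem_associatedPrimes [IsNoetherianRing R] {M : Type*}
    [AddCommGroup M] [Module R M] {p : Ideal R} (hp : p ∈ associatedPrimes R M) :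
    ∃ f : (R ⧸ p) →ₗ[R] M, Function.Injective f :=
  ((isAssociatedPrime_iff_exists_injective_linearMap p M).1 hp).2

lemma exists_linearMap_span_singleton_apply_eq_one [IsLocalRing R] {M : Type*}
    [AddCommGroup M] [Module R M] {z : M} (hz : z ≠ 0) :
    ∃ θ : (R ∙ z) →ₗ[R] R ⧸ maximalIdeal R,
      θ ⟨z, Submodule.mem_span_singleton_self z⟩ = 1 := by
  have hle : Ideal.torsionOf R M z ≤ maximalIdeal R :=
    le_maximalIdeal ((Ideal.torsionOf_eq_top_iff _ _).not.2 hz)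
  refine ⟨Submodule.factor hle ∘ₗ (Ideal.quotTorsionOfEquivSpanSingleton R M z).symm, ?_⟩
  have hone : (Ideal.quotTorsionOfEquivSpanSingleton R M z).symm
      ⟨z, Submodule.mem_span_singleton_self z⟩ = Submodule.Quotient.mk 1 := by
    rw [LinearEquiv.symm_apply_eq]
    exact Subtype.ext (one_smul R z).symm
  rw [LinearMap.comp_apply, LinearEquiv.coe_coe, hone]
  rfl

variable [IsNoetherianRing R] [IsLocalRing R] [Ring.KrullDimLE 1 R] {a : R}

lemma maximalIdeal_mem_associatedPrimes (ha : a ∈ nonZeroDivisors R)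
    (ham : a ∈ maximalIdeal R) :
    maximalIdeal R ∈ associatedPrimes R (R ⧸ Ideal.span {a}) := by
  have : Nontrivial (R ⧸ Ideal.span {a}) := by
    rwa [Ideal.Quotient.nontrivial_iff, Ne, Ideal.span_singleton_eq_top]
  obtain ⟨q, hq⟩ := associatedPrimes.nonempty R (R ⧸ Ideal.span {a})
  have haq : a ∈ q := by
    refine hq.annihilator_le ?_
    rw [Submodule.annihilator_top, Ideal.annihilator_quotient]
    exact Ideal.mem_span_singleton_self a
  rcases Ring.krullDimLE_one_iff.1 ‹_› q hq.isPrime with hmin | hmax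
  · exact absurd ha fun ha' ↦
      (Ideal.disjoint_nonZeroDivisors_of_mem_minimalPrimes hmin).le_bot ⟨haq, ha'⟩
  · rwa [← eq_maximalIdeal hmax]

lemma exists_injective_of_isPrime (ha : a ∈ nonZeroDivisors R) (ham : a ∈ maximalIdeal R)
    (p : Ideal R) (hp : p.IsPrime) :
    (∃ f : (R ⧸ p) →ₗ[R] R, Function.Injective f) ∨
      ∃ f : (R ⧸ p) →ₗ[R] R ⧸ Ideal.span {a}, Function.Injective f := by
  rcases Ring.krullDimLE_one_iff.1 ‹_› p hp with hmin | hmax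
  · left
    apply exists_injective_of_mem_associatedPrimes
    apply Module.associatedPrimes.minimalPrimes_annihilator_subset_associatedPrimes R R
    rwa [Module.annihilator_eq_bot.2 inferInstance]
  · right
    apply exists_injective_of_mem_associatedPrimes
    rw [eq_maximalIdeal hmax]
    exact maximalIdeal_mem_associatedPrimes ha ham

/- Every finite module is filtered by cyclic modules `R ⧸ p`, each of which embeds into `R` or
`R ⧸ (a)`; the higher `Ext` groups of these two vanish. -/
lemma ext_subsingleton_descend (ha : a ∈ nonZeroDivisors R) (ham : a ∈ maximalIdeal R)
    (Y : ModuleCat.{u} R) (n : ℕ)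
    (H : ∀ (N : Type u) [AddCommGroup N] [Module R N] [Module.Finite R N],
      Subsingleton (Ext (ModuleCat.of R N) Y (n + 3)))
    (N : Type u) [AddCommGroup N] [Module R N] [hN : Module.Finite R N] :
    Subsingleton (Ext (ModuleCat.of R N) Y (n + 2)) := by
  induction hN using IsNoetherianRing.induction_on_isQuotientEquivQuotientPrime R with
  | subsingleton N =>
    exact ext_subsingleton_left
      (shortExact_of_injective (Function.injective_of_subsingleton (0 : N →ₗ[R] R))) Y _
      (ext_ring_subsingleton Y _) (H _)
  | quotient N p e =>
    rcases exists_injective_of_isPrime ha ham p.1 p.2 with ⟨f, hf⟩ | ⟨f, hf⟩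
    · exact ext_subsingleton_left
        (shortExact_of_injective (f := f ∘ₗ e.toLinearMap) (hf.comp e.injective)) Y _
        (ext_ring_subsingleton Y _) (H _)
    · exact ext_subsingleton_left
        (shortExact_of_injective (f := f ∘ₗ e.toLinearMap) (hf.comp e.injective)) Y _
        (ext_quotient_span_singleton_subsingleton ha Y n) (H _)
  | exact N₁ N₂ N₃ f g hf hg h h₁ h₃ =>
    exact ext_subsingleton_middle (shortExact_of_exact hf hg h) Y _ h₁ h₃

lemma IsGorenstein.ext_two_subsingleton (hG : IsGorenstein R) (ha : a ∈ nonZeroDivisors R)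
    (ham : a ∈ maximalIdeal R) (N : Type u) [AddCommGroup N] [Module R N] [Module.Finite R N] :
    Subsingleton (Ext (ModuleCat.of R N) (ModuleCat.of R R) 2) := by
  obtain ⟨n, hn⟩ := (injectiveDimension_ne_top_iff _).1 hG
  suffices H : ∀ k ≤ n, ∀ (N : Type u) [AddCommGroup N] [Module R N] [Module.Finite R N],
      Subsingleton (Ext (ModuleCat.of R N) (ModuleCat.of R R) (k + 2)) from H 0 n.zero_le N
  intro k hk
  induction hk using Nat.decreasingInduction with
  | self =>
    exact fun N _ _ _ ↦ HasInjectiveDimensionLT.subsingleton (ModuleCat.of R R) (n + 1) _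
      (by lia) _
  | of_succ k _ ih => exact ext_subsingleton_descend ha ham _ k ih

lemma IsGorenstein.exists_lift (hG : IsGorenstein R) (ha : a ∈ nonZeroDivisors R)
    (ham : a ∈ maximalIdeal R) (I : Ideal R) (φ : I →ₗ[R] R ⧸ Ideal.span {a}) :
    ∃ ψ : I →ₗ[R] R, φ = (Ideal.span {a}).mkQ ∘ₗ ψ := by
  have hext : Subsingleton (Ext (ModuleCat.of R I) (ModuleCat.of R R) 1) :=
    ext_subsingleton_left (shortExact_of_injective I.injective_subtype) _ 1
      (ext_ring_subsingleton _ 0) (hG.ext_two_subsingleton ha ham _)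
  obtain ⟨x, hx⟩ := Ext.covariant_sequence_exact₃ (ModuleCat.of R I) (shortExact_mulLeft_mkQ ha)
    (Ext.mk₀ (ModuleCat.ofHom φ)) (zero_add 1) (hext.elim _ _)
  obtain ⟨ψ, rfl⟩ := (Ext.mk₀_bijective _ _).2 x
  rw [Ext.mk₀_comp_mk₀] at hx
  have hψ := (Ext.mk₀_bijective _ _).1 hx
  refine ⟨ψ.hom, ?_⟩
  rw [← ModuleCat.hom_ofHom φ, ← hψ]
  rfl

/-- The self-injectivity of `R ⧸ (a)`, for functionals on ideals of `R` that contain `a`. -/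
lemma IsGorenstein.exists_mul_of_apply_eq_zero (hG : IsGorenstein R)
    (ha : a ∈ nonZeroDivisors R) (ham : a ∈ maximalIdeal R) {I : Ideal R} (haI : a ∈ I)
    (φ : I →ₗ[R] R ⧸ Ideal.span {a}) (hφ : φ ⟨a, haI⟩ = 0) :
    ∃ r : R, ∀ i : I, φ i = (Ideal.span {a}).mkQ (r * i) := by
  obtain ⟨ψ, rfl⟩ := hG.exists_lift ha ham I φ
  obtain ⟨r, hr⟩ := mkQ_span_singleton_eq_zero_iff.1 hφ
  refine ⟨r, fun i ↦ congrArg _ ((mul_cancel_left_mem_nonZeroDivisors ha).1 ?_)⟩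
  calc a * ψ i = i * ψ ⟨a, haI⟩ := by
        rw [← smul_eq_mul, ← smul_eq_mul, ← map_smul, ← map_smul]
        exact congrArg ψ (Subtype.ext (mul_comm a i))
    _ = a * (r * i) := by rw [hr]; ring

/- A copy of the residue field in `R ⧸ (a)` yields a functional on `(z) + I` that kills `I` but
not `z`; by self-injectivity it is multiplication by some `r`. -/
lemma IsGorenstein.exists_dvd_mul_and_not_dvd_mul (hG : IsGorenstein R)
    (ha : a ∈ nonZeroDivisors R) {I : Ideal R} (haI : a ∈ I) {z : R} (hz : z ∉ I) :
    ∃ r, (∀ i ∈ I, a ∣ r * i) ∧ ¬ a ∣ r * z := by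
  have ham : a ∈ maximalIdeal R :=
    le_maximalIdeal (ne_of_mem_of_not_mem' Submodule.mem_top hz).symm haI
  obtain ⟨f, hf⟩ := exists_injective_of_mem_associatedPrimes
    (maximalIdeal_mem_associatedPrimes ha ham)
  obtain ⟨θ, hθ⟩ := exists_linearMap_span_singleton_apply_eq_one (R := R) (z := I.mkQ z)
    (by rwa [Submodule.mkQ_apply, Ne, Submodule.Quotient.mk_eq_zero])
  let φ : (R ∙ I.mkQ z).comap I.mkQ →ₗ[R] R ⧸ Ideal.span {a} :=
    f ∘ₗ θ ∘ₗ I.mkQ.restrict (fun x hx ↦ hx)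
  have hIP {i} (hi : i ∈ I) : i ∈ (R ∙ I.mkQ z).comap I.mkQ := I.le_comap_mkQ _ hi
  have hφI (i) (hi : i ∈ I) : φ ⟨i, hIP hi⟩ = 0 := by
    have : I.mkQ.restrict (q := R ∙ I.mkQ z) (fun x hx ↦ hx) ⟨i, hIP hi⟩ = 0 :=
      Subtype.ext ((Submodule.Quotient.mk_eq_zero I).2 hi)
    simp only [φ, LinearMap.comp_apply, this, map_zero]
  have hφz : φ ⟨z, Submodule.mem_span_singleton_self (I.mkQ z)⟩ ≠ 0 := by
    have : Nontrivial (R ⧸ maximalIdeal R) := inferInstance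
    rw [Ne, show φ _ = f (θ _) from rfl, map_eq_zero_iff f hf]
    exact hθ.trans_ne one_ne_zero
  obtain ⟨r, hr⟩ := hG.exists_mul_of_apply_eq_zero ha ham (hIP haI) φ (hφI a haI)
  refine ⟨r, fun i hi ↦ ?_, ?_⟩
  · rw [← mkQ_span_singleton_eq_zero_iff, ← hr ⟨i, hIP hi⟩, hφI i hi]
  · rwa [← mkQ_span_singleton_eq_zero_iff, ← hr ⟨z, _⟩]

end GorensteinReflexive

section Linked

variable {R : Type*} [CommRing R] {a : R} {I K : Ideal R}

/-- The ideals `I` and `K` are linked by `a`: each is the colon ideal of `(a)` by the other. When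
`a` is regular, `K` is then the image of `I^*` under evaluation at `a`, i.e. `K = a I⁻¹` as
fractional ideals. -/
structure Linked (a : R) (I K : Ideal R) : Prop where
  mem_left_iff : ∀ {x}, x ∈ I ↔ ∀ y ∈ K, a ∣ x * y
  mem_right_iff : ∀ {y}, y ∈ K ↔ ∀ x ∈ I, a ∣ y * x

namespace Linked

lemma symm (h : Linked a I K) : Linked a K I := ⟨h.mem_right_iff, h.mem_left_iff⟩

lemma mem_left (h : Linked a I K) : a ∈ I := h.mem_left_iff.2 fun y _ ↦ dvd_mul_right a y

lemma dvd_mul (h : Linked a I K) {x y : R} (hx : x ∈ I) (hy : y ∈ K) : a ∣ x * y :=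
  h.mem_left_iff.1 hx y hy

lemma isPrincipal_left (h : Linked a I K) (ha : a ∈ nonZeroDivisors R)
    (hK : K.IsPrincipal) : I.IsPrincipal := by
  obtain ⟨b, rfl⟩ := hK
  obtain ⟨c, rfl⟩ := Ideal.mem_span_singleton.1 h.symm.mem_left
  refine ⟨c, Submodule.ext fun x ↦ ?_⟩
  have hb : b ∈ nonZeroDivisors R := (mul_mem_nonZeroDivisors.1 ha).1
  rw [h.mem_left_iff, Ideal.submodule_span_eq, Ideal.mem_span_singleton]
  constructor
  · intro hx
    obtain ⟨t, ht⟩ := hx b (Submodule.mem_span_singleton_self b)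
    exact ⟨t, (mul_cancel_left_mem_nonZeroDivisors hb).1 (by rw [mul_comm, ht, mul_assoc])⟩
  · rintro ⟨t, rfl⟩ y hy
    obtain ⟨s, rfl⟩ := Ideal.mem_span_singleton.1 hy
    exact ⟨t * s, by ring⟩

end Linked

lemma exists_smul_eq_of_forall_dvd {M : Type*} [AddCommGroup M] [Module R M]
    (ha : a ∈ nonZeroDivisors R) (g : M →ₗ[R] R) (hg : ∀ m, a ∣ g m) :
    ∃ f : M →ₗ[R] R, a • f = g := by
  have hinj := mulLeft_injective_of_mem_nonZeroDivisors ha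
  refine ⟨(LinearEquiv.ofInjective _ hinj).symm.toLinearMap ∘ₗ
    g.codRestrict (LinearMap.range (LinearMap.mulLeft R a))
      fun m ↦ (hg m).imp fun _ h ↦ h.symm, ?_⟩
  ext m
  exact congrArg Subtype.val ((LinearEquiv.ofInjective _ hinj).apply_symm_apply _)

lemma mul_dual_apply (f : Module.Dual R I) (x y : I) : (x : R) * f y = y * f x := by
  rw [← smul_eq_mul, ← smul_eq_mul, ← map_smul, ← map_smul]
  exact congrArg f (Subtype.ext (mul_comm _ _))

lemma dual_ext_of_apply_eq (ha : a ∈ nonZeroDivisors R) (haI : a ∈ I) {f g : Module.Dual R I}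
    (hfg : f ⟨a, haI⟩ = g ⟨a, haI⟩) : f = g := by
  ext x
  have hf := mul_dual_apply f ⟨a, haI⟩ x
  have hg := mul_dual_apply g ⟨a, haI⟩ x
  exact (mul_cancel_left_mem_nonZeroDivisors ha).1 (by simp only at hf hg; rw [hf, hg, hfg])

namespace Linked

lemma exists_dual_apply_eq (h : Linked a I K) (ha : a ∈ nonZeroDivisors R) {y : R}
    (hy : y ∈ K) : ∃ f : Module.Dual R I, f ⟨a, h.mem_left⟩ = y := by
  obtain ⟨f, hf⟩ := exists_smul_eq_of_forall_dvd ha (LinearMap.mulRight R y ∘ₗ I.subtype)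
    fun x ↦ h.dvd_mul x.2 hy
  exact ⟨f, (mul_cancel_left_mem_nonZeroDivisors ha).1 (LinearMap.congr_fun hf _)⟩

lemma dual_apply_mem (h : Linked a I K) (f : Module.Dual R I) : f ⟨a, h.mem_left⟩ ∈ K :=
  h.mem_right_iff.2 fun x hx ↦ ⟨f ⟨x, hx⟩, by
    rw [mul_comm, mul_dual_apply f ⟨x, hx⟩ ⟨a, h.mem_left⟩]⟩

/-- The isomorphism `I^* ≃ K` given by evaluation at `a`. -/
noncomputable def dualEquiv (h : Linked a I K) (ha : a ∈ nonZeroDivisors R) :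
    Module.Dual R I ≃ₗ[R] K :=
  LinearEquiv.ofBijective
    ((Module.Dual.eval R I ⟨a, h.mem_left⟩).codRestrict K h.dual_apply_mem)
    ⟨fun _ _ hfg ↦ dual_ext_of_apply_eq ha h.mem_left (congrArg Subtype.val hfg),
      fun y ↦ (h.exists_dual_apply_eq ha y.2).imp fun _ hf ↦ Subtype.ext hf⟩

end Linked

lemma linked_colon
    (hI : ∀ z, (∀ r, (∀ i ∈ I, a ∣ r * i) → a ∣ r * z) → z ∈ I) :
    Linked a I ((Ideal.span {a}).colon I) := by
  have hmem {r} : r ∈ (Ideal.span {a}).colon I ↔ ∀ i ∈ I, a ∣ r * i := by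
    simp [Submodule.mem_colon, Ideal.mem_span_singleton]
  refine ⟨⟨fun hx r hr ↦ mul_comm r _ ▸ hmem.1 hr _ hx, fun hx ↦ hI _ fun r hr ↦ ?_⟩, hmem⟩
  exact mul_comm r _ ▸ hx r (hmem.2 hr)

lemma Linked.isReflexive (h : Linked a I K) (ha : a ∈ nonZeroDivisors R) :
    Module.IsReflexive R I := by
  refine ⟨fun x y hxy ↦ Subtype.ext (LinearMap.congr_fun hxy I.subtype), fun Φ ↦ ?_⟩
  set z := Φ I.subtype with hz
  have hΦ (f : Module.Dual R I) : a * Φ f = z * f ⟨a, h.mem_left⟩ := by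
    rw [hz, mul_comm (Φ _), ← smul_eq_mul, ← smul_eq_mul, ← map_smul, ← map_smul]
    exact congrArg Φ (LinearMap.ext fun x ↦ by
      simpa [mul_comm] using mul_dual_apply f ⟨a, h.mem_left⟩ x)
  have hzI : z ∈ I := h.mem_left_iff.2 fun y hy ↦ by
    obtain ⟨f, rfl⟩ := h.exists_dual_apply_eq ha hy
    exact ⟨Φ f, (hΦ f).symm⟩
  refine ⟨⟨z, hzI⟩, LinearMap.ext fun f ↦ (mul_cancel_left_mem_nonZeroDivisors ha).1 ?_⟩
  rw [hΦ]
  exact mul_dual_apply f ⟨a, h.mem_left⟩ ⟨z, hzI⟩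

/- An element `z` of `(a) : ((a) : I)` defines the functional `f ↦ z * f a / a` on `I^*`. -/
lemma exists_linked_of_isReflexive [Module.IsReflexive R I] (ha : a ∈ nonZeroDivisors R)
    (haI : a ∈ I) : ∃ K, Linked a I K := by
  refine ⟨_, linked_colon fun z hz ↦ ?_⟩
  obtain ⟨Φ, hΦ⟩ := exists_smul_eq_of_forall_dvd ha (z • Module.Dual.eval R I ⟨a, haI⟩) fun f ↦ by
    rw [LinearMap.smul_apply, Module.Dual.eval_apply, smul_eq_mul, mul_comm]
    exact hz _ fun x hx ↦ ⟨f ⟨x, hx⟩, by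
      rw [mul_comm, mul_dual_apply f ⟨x, hx⟩ ⟨a, haI⟩]⟩
  obtain ⟨w, rfl⟩ := (Module.bijective_dual_eval R I).2 Φ
  have hw : a * w = z * a := LinearMap.congr_fun hΦ I.subtype
  rw [mul_comm z, mul_cancel_left_mem_nonZeroDivisors ha] at hw
  exact hw ▸ w.2

end Linked

lemma IsGorenstein.isReflexive {R : Type u} [CommRing R] [IsNoetherianRing R] [IsLocalRing R]
    [Ring.KrullDimLE 1 R] (hG : IsGorenstein R) {I : Ideal R}
    (hreg : ∃ a ∈ I, a ∈ nonZeroDivisors R) : Module.IsReflexive R I := by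
  obtain ⟨a, haI, ha⟩ := hreg
  refine (linked_colon (a := a) fun z hz ↦ ?_).isReflexive ha
  by_contra hzI
  obtain ⟨r, hrI, hrz⟩ := hG.exists_dvd_mul_and_not_dvd_mul ha haI hzI
  exact hrz (hz r hrI)

section RelLength

variable {R : Type*} [CommRing R] {M X : Type*} [AddCommGroup M] [Module R M] [AddCommGroup X]
  [Module R X] {P Q W : Submodule R M}

/-- The length of `P / (P ⊓ Q)` for submodules `P` and `Q` of a common module; it is only of
interest for `Q ≤ P`. -/
noncomputable def relLength (P Q : Submodule R M) : ℕ∞ :=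
  Module.length R (P ⧸ Q.submoduleOf P)

lemma relLength_eq_length_range (φ : P →ₗ[R] X) (hφ : ∀ x : P, φ x = 0 ↔ (x : M) ∈ Q) :
    relLength P Q = Module.length R (LinearMap.range φ) := by
  have hker : Q.submoduleOf P = LinearMap.ker φ := Submodule.ext fun x ↦ (hφ x).symm
  rw [relLength, hker, φ.quotKerEquivRange.length_eq]

lemma relLength_eq_length_map_mkQ (P Q : Submodule R M) :
    relLength P Q = Module.length R (P.map Q.mkQ) := by
  rw [relLength_eq_length_range (Q.mkQ ∘ₗ P.subtype) fun x ↦ Submodule.Quotient.mk_eq_zero Q,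
    LinearMap.range_comp, Submodule.range_subtype]

lemma relLength_top (Q : Submodule R M) : relLength ⊤ Q = Module.length R (M ⧸ Q) := by
  rw [relLength_eq_length_map_mkQ, Submodule.map_top, Submodule.range_mkQ, Module.length_top]

lemma relLength_sup_right (P Q : Submodule R M) : relLength (P ⊔ Q) Q = relLength P Q := by
  rw [relLength_eq_length_map_mkQ, relLength_eq_length_map_mkQ, Submodule.map_sup,
    Submodule.mkQ_map_self, sup_bot_eq]

lemma relLength_le_of_inf_le {Q' : Submodule R M} (h : P ⊓ Q ≤ Q') :
    relLength P Q' ≤ relLength P Q := by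
  have hle : Q.submoduleOf P ≤ Q'.submoduleOf P := fun x hx ↦ h ⟨x.2, hx⟩
  exact Module.length_le_of_surjective (Submodule.factor hle) (Submodule.factor_surjective hle)

lemma relLength_map_left (f : M →ₗ[R] X) (P : Submodule R M) (Q' : Submodule R X) :
    relLength (P.map f) Q' = relLength P (Q'.comap f) := by
  rw [relLength_eq_length_map_mkQ, relLength_eq_length_range (P := P) (Q := Q'.comap f)
    (Q'.mkQ ∘ₗ f ∘ₗ P.subtype) fun x ↦ Submodule.Quotient.mk_eq_zero Q', LinearMap.range_comp,
    LinearMap.range_comp, Submodule.range_subtype]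

lemma relLength_map (P Q : Submodule R M) {f : M →ₗ[R] X} (hf : Function.Injective f) :
    relLength (P.map f) (Q.map f) = relLength P Q := by
  rw [relLength_map_left, Submodule.comap_map_eq_of_injective hf]

lemma relLength_map_le (f : M →ₗ[R] X) (P Q : Submodule R M) :
    relLength (P.map f) (Q.map f) ≤ relLength P Q := by
  rw [relLength_map_left]
  exact relLength_le_of_inf_le (inf_le_right.trans (Submodule.le_comap_map f Q))

lemma relLength_le_card_mul {ι : Type*} [Fintype ι] {P' Q' : Submodule R X} (f : ι → M →ₗ[R] X)
    (hP : ∀ i, P.map (f i) ≤ P') (hQ : P ⊓ ⨅ i, Q'.comap (f i) ≤ Q) :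
    relLength P Q ≤ Fintype.card ι * relLength P' Q' := by
  let φ : P →ₗ[R] ι → P' ⧸ Q'.submoduleOf P' := LinearMap.pi fun i ↦
    (Q'.submoduleOf P').mkQ ∘ₗ (f i).restrict (Submodule.map_le_iff_le_comap.1 (hP i))
  have hφ (x : P) : φ x = 0 ↔ (x : M) ∈ ⨅ i, Q'.comap (f i) := by
    rw [Submodule.mem_iInf, funext_iff]
    exact forall_congr' fun i ↦ Submodule.Quotient.mk_eq_zero _
  calc relLength P Q ≤ relLength P (⨅ i, Q'.comap (f i)) := relLength_le_of_inf_le hQ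
    _ = Module.length R (LinearMap.range φ) := relLength_eq_length_range φ hφ
    _ ≤ Module.length R (ι → P' ⧸ Q'.submoduleOf P') :=
      Module.length_le_of_injective _ (Submodule.injective_subtype _)
    _ = Fintype.card ι * relLength P' Q' := by simp [Module.length_pi_of_fintype, relLength]

lemma relLength_eq_zero_iff : relLength P Q = 0 ↔ P ≤ Q := by
  rw [relLength, Module.length_eq_zero_iff, Submodule.Quotient.subsingleton_iff,
    Submodule.submoduleOf_eq_top]

lemma relLength_eq_add (hQP : Q ≤ P) (hWQ : W ≤ Q) :
    relLength P W = relLength P Q + relLength Q W := by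
  let φ : Q →ₗ[R] P ⧸ W.submoduleOf P := (W.submoduleOf P).mkQ ∘ₗ Submodule.inclusion hQP
  have hrange : LinearMap.range φ = (Q.submoduleOf P).map (W.submoduleOf P).mkQ := by
    rw [LinearMap.range_comp, Submodule.range_inclusion]
    rfl
  have hWQ' : W.submoduleOf P ≤ Q.submoduleOf P := Submodule.comap_mono hWQ
  have hPQ : relLength P Q = Module.length R
      ((P ⧸ W.submoduleOf P) ⧸ (Q.submoduleOf P).map (W.submoduleOf P).mkQ) :=
    (Submodule.quotientQuotientEquivQuotient _ _ hWQ').length_eq.symm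
  rw [relLength_eq_length_range φ fun x ↦ Submodule.Quotient.mk_eq_zero _, hrange, hPQ, add_comm]
  exact Module.length_eq_add_of_exact (Submodule.subtype _) (Submodule.mkQ _)
    (Submodule.injective_subtype _) (Submodule.mkQ_surjective _)
    (LinearMap.exact_subtype_mkQ _)

end RelLength

section Nu

variable {R : Type*} [CommRing R]

lemma nu_submodule {M : Type*} [AddCommGroup M] [Module R M] (N : Submodule R M) :
    nu R N = N.spanFinrank :=
  Submodule.spanFinrank_top N

lemma nu_congr {M N : Type*} [AddCommGroup M] [Module R M] [AddCommGroup N] [Module R N]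
    (e : M ≃ₗ[R] N) : nu R M = nu R N := by
  rw [nu, nu, ← Submodule.spanFinrank_map_eq_of_injective e.toLinearMap e.injective,
    Submodule.map_top, LinearMap.range_eq_top.2 e.surjective]

lemma nu_le_one_of_isPrincipal {J : Ideal R} (hJ : J.IsPrincipal) : nu R J ≤ 1 := by
  obtain ⟨b, rfl⟩ := hJ
  rw [nu_submodule]
  exact (Submodule.spanFinrank_span_le_ncard_of_finite (Set.finite_singleton b)).trans (by simp)

lemma isPrincipal_of_nu_le_one {J : Ideal R} (hJ : J.FG) (h : nu R J ≤ 1) : J.IsPrincipal := by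
  obtain ⟨s, hs, rfl⟩ := Submodule.FG.exists_span_finset_card_eq_spanFinrank hJ
  rw [nu_submodule, ← hs, Finset.card_le_one_iff_subset_singleton] at h
  obtain ⟨x, hx⟩ := h
  rcases Finset.subset_singleton_iff.1 hx with rfl | rfl
  · simpa using bot_isPrincipal
  · exact ⟨x, by simp⟩

lemma exists_span_pair_eq_top_of_nu_eq_two {M : Type*} [AddCommGroup M] [Module R M]
    [Module.Finite R M] (h : nu R M = 2) : ∃ x y : M, Submodule.span R {x, y} = ⊤ := by
  obtain ⟨s, hs, hs'⟩ := Submodule.FG.exists_span_finset_card_eq_spanFinrank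
    (Module.Finite.fg_top (R := R) (M := M))
  classical
  obtain ⟨x, y, -, rfl⟩ := Finset.card_eq_two.1 (hs.trans h)
  exact ⟨x, y, by simpa using hs'⟩

variable [IsLocalRing R]

lemma nu_eq_finrank (M : Type*) [AddCommGroup M] [Module R M] [Module.Finite R M] :
    nu R M = Module.finrank (ResidueField R) (ResidueField R ⊗[R] M) := by
  rw [nu, ← TensorProduct.spanFinrank_top_eq_of_residueField ⊤ Module.Finite.fg_top,
    ← Module.finrank_eq_spanFinrank_of_free]
  exact LinearEquiv.finrank_eq
    (TensorProduct.AlgebraTensorModule.congr (LinearEquiv.refl _ _) Submodule.topEquiv)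

lemma nu_tensorProduct (M N : Type*) [AddCommGroup M] [Module R M] [Module.Finite R M]
    [AddCommGroup N] [Module R N] [Module.Finite R N] :
    nu R (M ⊗[R] N) = nu R M * nu R N := by
  rw [nu_eq_finrank, nu_eq_finrank, nu_eq_finrank,
    (TensorProduct.AlgebraTensorModule.distribBaseChange R (ResidueField R) M N).finrank_eq,
    Module.finrank_tensorProduct]

lemma nu_baseChange (S : Type*) [CommRing S] [IsLocalRing S] [Algebra R S]
    [IsLocalHom (algebraMap R S)] (M : Type*) [AddCommGroup M] [Module R M] [Module.Finite R M] :
    nu S (S ⊗[R] M) = nu R M := by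
  rw [nu_eq_finrank, nu_eq_finrank,
    ← Module.finrank_baseChange (R := ResidueField S) (S := ResidueField R)]
  exact ((TensorProduct.AlgebraTensorModule.cancelBaseChange R S (ResidueField S)
      (ResidueField S) M).trans
    (TensorProduct.AlgebraTensorModule.cancelBaseChange R (ResidueField R) (ResidueField S)
      (ResidueField S) M).symm).finrank_eq

lemma nu_map_of_flat (S : Type*) [CommRing S] [IsLocalRing S] [Algebra R S]
    [IsLocalHom (algebraMap R S)] [Module.Flat R S] {N : Ideal R} (hN : N.FG) :
    nu S (N.map (algebraMap R S)) = nu R N := by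
  have : Module.Finite R N := Module.Finite.iff_fg.2 hN
  let f : S ⊗[R] N →ₗ[S] S := (Algebra.linearMap R S ∘ₗ N.subtype).liftBaseChange S
  have hf : Function.Injective f := by
    have hcomp : f.restrictScalars R = (TensorProduct.rid R S).toLinearMap ∘ₗ
        N.subtype.lTensor S := TensorProduct.ext' fun s x ↦ by
      simp [f, Algebra.smul_def, mul_comm]
    have hinj := (TensorProduct.rid R S).injective.comp
      (Module.Flat.lTensor_preserves_injective_linearMap N.subtype N.injective_subtype)
    exact fun x y hxy ↦ hinj <|
      (LinearMap.congr_fun hcomp x).symm.trans (hxy.trans (LinearMap.congr_fun hcomp y))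
  have hrange : LinearMap.range f = N.map (algebraMap R S) := by
    rw [LinearMap.range_liftBaseChange, LinearMap.range_comp, Submodule.range_subtype]
    rfl
  rw [← nu_baseChange S N, ← hrange, nu_congr (LinearEquiv.ofInjective f hf)]

lemma nu_eq_length (M : Type*) [AddCommGroup M] [Module R M] [Module.Finite R M] :
    (nu R M : ℕ∞) = Module.length R (M ⧸ maximalIdeal R • (⊤ : Submodule R M)) := by
  rw [nu_eq_finrank, ← Module.length_eq_finrank, ← Module.length_eq_of_surjective
    (S := R) (R := ResidueField R) residue_surjective]
  exact (TensorProduct.quotTensorEquivQuotSMul M (maximalIdeal R)).length_eq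

lemma nu_eq_relLength {M : Type*} [AddCommGroup M] [Module R M] {N : Submodule R M} (hN : N.FG) :
    (nu R N : ℕ∞) = relLength N (maximalIdeal R • N) := by
  have : Module.Finite R N := Module.Finite.iff_fg.2 hN
  suffices h : maximalIdeal R • (⊤ : Submodule R N) = (maximalIdeal R • N).submoduleOf N by
    rw [nu_eq_length, relLength, h]
  apply Submodule.map_injective_of_injective N.injective_subtype
  rw [Submodule.map_smul'', Submodule.map_top, Submodule.range_subtype, Submodule.submoduleOf,
    Submodule.map_comap_subtype, inf_eq_right.2 Submodule.smul_le_right]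

end Nu

section TorsionFree

variable {R : Type*} [CommRing R] {a : R} {I : Ideal R}

lemma dual_apply_mem_trace {M : Type*} [AddCommGroup M] [Module R M] (f : Module.Dual R M)
    (x : M) : f x ∈ trace R M :=
  ⟨f ⊗ₜ x, contractLeft_apply f x⟩

lemma le_trace : I ≤ trace R I := fun x hx ↦ dual_apply_mem_trace I.subtype ⟨x, hx⟩

lemma Linked.mul_le {K : Ideal R} (h : Linked a I K) (ha : a ∈ nonZeroDivisors R) :
    I * K ≤ Ideal.span {a} * trace R I := by
  refine Ideal.mul_le.2 fun x hx y hy ↦ ?_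
  obtain ⟨f, rfl⟩ := h.exists_dual_apply_eq ha hy
  rw [mul_dual_apply f ⟨x, hx⟩ ⟨a, h.mem_left⟩]
  exact Ideal.mul_mem_mul (Ideal.mem_span_singleton_self a) (dual_apply_mem_trace f _)

lemma smul_subtype_eq_apply_smul (f : Module.Dual R I) (x : I) :
    (x : R) • f = f x • (I.subtype : Module.Dual R I) := by
  ext y
  exact (mul_dual_apply f x y).trans (mul_comm _ _)

lemma rTensor_subtype_injective {M : Type*} [AddCommGroup M] [Module R M]
    (haI : a ∈ I) (ha : a ∈ nonZeroDivisors R) (htf : Module.IsTorsionFree R (I ⊗[R] M)) :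
    Function.Injective (I.subtype.rTensor M) := by
  have key (t : I ⊗[R] M) :
      a • t = (⟨a, haI⟩ : I) ⊗ₜ[R] TensorProduct.lid R M (I.subtype.rTensor M t) := by
    induction t with
    | zero => simp
    | tmul i m =>
      have hai : a • i = (i : R) • (⟨a, haI⟩ : I) := Subtype.ext (mul_comm _ _)
      rw [LinearMap.rTensor_tmul, TensorProduct.lid_tmul, TensorProduct.smul_tmul', hai,
        TensorProduct.smul_tmul]
      rfl
    | add s t hs ht => rw [smul_add, hs, ht, map_add, map_add, TensorProduct.tmul_add]
  intro s t hst
  exact htf.isSMulRegular (isRegular_iff_mem_nonZeroDivisors.2 ha)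
    ((key s).trans (hst ▸ (key t).symm))

lemma contractLeft_injective
    (hinj : Function.Injective (I.subtype.rTensor (Module.Dual R I))) :
    Function.Injective (contractLeft R I) := by
  have key (t : Module.Dual R I ⊗[R] I) : TensorProduct.lid R _
      (I.subtype.rTensor (Module.Dual R I) (TensorProduct.comm R _ _ t)) =
        contractLeft R I t • (I.subtype : Module.Dual R I) := by
    induction t with
    | zero => simp
    | tmul f i => simpa using smul_subtype_eq_apply_smul f i
    | add s t hs ht => simp only [map_add, hs, ht, add_smul]
  intro s t hst
  refine (TensorProduct.comm R _ _).injective (hinj ((TensorProduct.lid R _).injective ?_))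
  rw [key, key, hst]

lemma finite_dual [IsNoetherianRing R] (haI : a ∈ I) (ha : a ∈ nonZeroDivisors R) :
    Module.Finite R (Module.Dual R I) :=
  Module.Finite.of_injective (Module.Dual.eval R I ⟨a, haI⟩) fun _ _ ↦ dual_ext_of_apply_eq ha haI

lemma nu_trace [IsNoetherianRing R] [IsLocalRing R] [Module.Finite R (Module.Dual R I)]
    (hinj : Function.Injective (I.subtype.rTensor (Module.Dual R I))) :
    nu R (trace R I) = nu R I * nu R (Module.Dual R I) := by
  rw [mul_comm, ← nu_tensorProduct]
  exact (nu_congr (LinearEquiv.ofInjective _ (contractLeft_injective hinj))).symm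

end TorsionFree

section TwoGenerated

variable {R : Type*} [CommRing R] {M : Type*} [AddCommGroup M] [Module R M]

lemma length_quotient_smul_top_of_exact {A F C : Type*} [AddCommGroup A] [Module R A]
    [AddCommGroup F] [Module R F] [AddCommGroup C] [Module R C] {u : A →ₗ[R] F} {w : F →ₗ[R] C}
    (huw : Function.Exact u w) (hw : Function.Surjective w) (I : Ideal R) :
    Module.length R (F ⧸ I • (⊤ : Submodule R F)) =
      Module.length R (A ⧸ (I • (⊤ : Submodule R F)).comap u) +
        Module.length R (C ⧸ I • (⊤ : Submodule R C)) := by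
  have hwI : (I • (⊤ : Submodule R C)).comap w = LinearMap.range u ⊔ I • ⊤ := by
    rw [← LinearMap.range_eq_top.2 hw, LinearMap.range_eq_map, ← Submodule.map_smul'',
      Submodule.comap_map_eq, LinearMap.exact_iff.1 huw, sup_comm]
  refine Module.length_eq_add_of_exact (Submodule.mapQ _ _ u le_rfl)
    (Submodule.mapQ _ _ w (hwI.ge.trans' le_sup_right)) ?_ ?_ ?_
  · rw [← LinearMap.ker_eq_bot, Submodule.ker_mapQ, Submodule.mkQ_map_self]
  · rw [← LinearMap.range_eq_top, Submodule.range_mapQ, LinearMap.range_eq_top.2 hw,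
      Submodule.map_top, Submodule.range_mkQ]
  · rw [LinearMap.exact_iff, Submodule.ker_mapQ, Submodule.range_mapQ, hwI, Submodule.map_sup,
      Submodule.mkQ_map_self, sup_bot_eq]

lemma lid_rTensor_lTensor (I : Ideal R) {N : Type*} [AddCommGroup N] [Module R N]
    (f : M →ₗ[R] N) (t : I ⊗[R] M) :
    TensorProduct.lid R N (I.subtype.rTensor N (f.lTensor I t)) =
      f (TensorProduct.lid R M (I.subtype.rTensor M t)) := by
  induction t with
  | zero => simp
  | tmul i m => simp
  | add s t hs ht => simp only [map_add, hs, ht]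

lemma comap_smul_top_eq_of_rTensor_injective {A F C : Type*} [AddCommGroup A] [Module R A]
    [AddCommGroup F] [Module R F] [AddCommGroup C] [Module R C] {u : A →ₗ[R] F} {w : F →ₗ[R] C}
    (hu : Function.Injective u) (huw : Function.Exact u w) (hw : Function.Surjective w)
    {I : Ideal R} (hI : Function.Injective (I.subtype.rTensor C)) :
    (I • (⊤ : Submodule R F)).comap u = I • ⊤ := by
  refine le_antisymm (fun z hz ↦ ?_) (Submodule.smul_top_le_comap_smul_top I u)
  obtain ⟨t, ht : TensorProduct.lid R F _ = u z⟩ := (I.subtype_rTensor_range F).ge hz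
  have hwt : w.lTensor I t = 0 := by
    refine hI ((TensorProduct.lid R C).injective ?_)
    rw [lid_rTensor_lTensor, ht, huw.apply_apply_eq_zero, map_zero, map_zero]
  obtain ⟨s, rfl⟩ := (lTensor_exact I huw hw t).1 hwt
  exact (I.subtype_rTensor_range A).le ⟨s, hu (by rw [← ht, lid_rTensor_lTensor]; rfl)⟩

lemma length_prod_quotient_smul_top (I : Ideal R) :
    Module.length R ((R × R) ⧸ I • (⊤ : Submodule R (R × R))) =
      Module.length R (R ⧸ I) + Module.length R (R ⧸ I) := by
  rw [← (TensorProduct.quotTensorEquivQuotSMul (R × R) I).length_eq,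
    (TensorProduct.prodRight R R (R ⧸ I) R R).length_eq, Module.length_prod,
    (TensorProduct.rid R (R ⧸ I)).length_eq]

/-- The map `f ↦ (f y, -f x)` from `M^*` to `R²`. For a module `M` of rank one generated by `x` and
`y`, its image is the module of relations between `x` and `y`. -/
def koszulDual (x y : M) : Module.Dual R M →ₗ[R] R × R :=
  (Module.Dual.eval R M y).prod (-Module.Dual.eval R M x)

lemma koszulDual_injective {x y : M} (hxy : Submodule.span R {x, y} = ⊤) :
    Function.Injective (koszulDual (R := R) x y) := by
  intro f g hfg
  obtain ⟨hy, hx⟩ := Prod.ext_iff.1 hfg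
  refine LinearMap.ext_on hxy ?_
  rintro z (rfl | rfl)
  · exact neg_injective hx
  · exact hy

lemma surjective_coprod_toSpanSingleton {x y : M} (hxy : Submodule.span R {x, y} = ⊤) :
    Function.Surjective
      ((LinearMap.toSpanSingleton R M x).coprod (LinearMap.toSpanSingleton R M y)) := fun z ↦ by
  obtain ⟨r, s, h⟩ := Submodule.mem_span_pair.1 (hxy.ge (Submodule.mem_top (x := z)))
  exact ⟨(r, s), h⟩

/- The functional with `f y = r` and `f x = -s` sends `α x + β y` to `β r - α s`. -/
lemma exact_koszulDual [FaithfulSMul R M] {x y : M} (hxy : Submodule.span R {x, y} = ⊤)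
    (hrank : ∀ f : Module.Dual R M, f x • y = f y • x) :
    Function.Exact (koszulDual (R := R) x y)
      ((LinearMap.toSpanSingleton R M x).coprod (LinearMap.toSpanSingleton R M y)) := by
  set w := (LinearMap.toSpanSingleton R M x).coprod (LinearMap.toSpanSingleton R M y)
  rintro ⟨r, s⟩
  constructor
  · intro hrs
    have hrs' : r • x + s • y = 0 := hrs
    let g : R × R →ₗ[R] R := r • LinearMap.snd R R R - s • LinearMap.fst R R R
    have hker : LinearMap.ker w ≤ LinearMap.ker g := by
      rintro ⟨α, β⟩ hαβ
      have hαβ' : α • x + β • y = 0 := hαβ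
      refine FaithfulSMul.eq_of_smul_eq_smul (α := M) fun z ↦ ?_
      obtain ⟨γ, ε, rfl⟩ := Submodule.mem_span_pair.1 (hxy.ge (Submodule.mem_top (x := z)))
      have hg : g (α, β) = r * β - s * α := rfl
      rw [hg, zero_smul]
      linear_combination (norm := module) (ε * r - γ * s) • hαβ' + (γ * β - ε * α) • hrs'
    let e := w.quotKerEquivOfSurjective (surjective_coprod_toSpanSingleton hxy)
    have hf (q : R × R) : ((LinearMap.ker w).liftQ g hker ∘ₗ e.symm.toLinearMap) (w q) = g q :=
      congrArg _ (e.symm_apply_apply ((LinearMap.ker w).mkQ q))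
    refine ⟨(LinearMap.ker w).liftQ g hker ∘ₗ e.symm.toLinearMap, Prod.ext ?_ ?_⟩
    · simpa [koszulDual, w, g] using hf (0, 1)
    · simpa [koszulDual, w, g] using congrArg Neg.neg (hf (1, 0))
  · rintro ⟨f, hf⟩
    rw [← hf]
    simp [koszulDual, w, hrank f]

lemma comap_koszulDual_smul_top [Module.IsReflexive R M] [FaithfulSMul R M]
    [FaithfulSMul R (Module.Dual R M)]
    (hrank : ∀ (f : Module.Dual R M) (x y : M), f x • y = f y • x) {x y : M}
    (hxy : Submodule.span R {x, y} = ⊤) {c d : Module.Dual R M}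
    (hcd : Submodule.span R {c, d} = ⊤) {I : Ideal R} (hI : Module.length R (R ⧸ I) ≠ ⊤)
    (hinj : Function.Injective (I.subtype.rTensor (Module.Dual R M))) :
    (I • (⊤ : Submodule R (R × R))).comap (koszulDual x y) = I • ⊤ := by
  have hrank' (Φ : Module.Dual R (Module.Dual R M)) : Φ c • d = Φ d • c := by
    obtain ⟨z, rfl⟩ := (Module.evalEquiv R M).surjective Φ
    ext w
    simpa [mul_comm] using (congrArg d (hrank c z w))
  have hexact := exact_koszulDual hxy (hrank · x y)
  have hexact' := exact_koszulDual hcd hrank'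
  have hw := surjective_coprod_toSpanSingleton hxy
  have hw' := surjective_coprod_toSpanSingleton hcd
  have hlen := length_quotient_smul_top_of_exact hexact hw I
  have hlen' := length_quotient_smul_top_of_exact hexact' hw' I
  rw [comap_smul_top_eq_of_rTensor_injective (koszulDual_injective hcd) hexact' hw' hinj] at hlen'
  set B := (I • (⊤ : Submodule R (R × R))).comap (koszulDual x y)
  have hIB : I • (⊤ : Submodule R (Module.Dual R M)) ≤ B := Submodule.smul_top_le_comap_smul_top I _
  have hadd := relLength_eq_add (le_top (a := B)) hIB
  rw [relLength_top, relLength_top] at hadd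
  have hfin : Module.length R (Module.Dual R M ⧸ B) +
      Module.length R (M ⧸ I • (⊤ : Submodule R M)) ≠ ⊤ := by
    rw [← hlen, length_prod_quotient_smul_top]
    exact WithTop.add_ne_top.2 ⟨hI, hI⟩
  have hmap : (I • (⊤ : Submodule R M)).map (Module.evalEquiv R M).toLinearMap = I • ⊤ := by
    rw [Submodule.map_smul'', Submodule.map_top, LinearEquiv.range]
  rw [hlen, hadd, ← (Submodule.Quotient.equiv _ _ (Module.evalEquiv R M) hmap).length_eq,
    ← add_assoc, add_comm (Module.length R (M ⧸ _))] at hlen'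
  refine le_antisymm (relLength_eq_zero_iff.1 ?_) hIB
  exact (ENat.addLECancellable_of_ne_top hfin).inj.1 (by rw [← hlen', add_zero])

end TwoGenerated

section SixLe

variable {R : Type*} [CommRing R] {a : R} {I : Ideal R}

lemma faithfulSMul_of_mem (haI : a ∈ I) (ha : a ∈ nonZeroDivisors R) : FaithfulSMul R I where
  eq_of_smul_eq_smul h := (mul_cancel_right_mem_nonZeroDivisors ha).1
    (congrArg Subtype.val (h ⟨a, haI⟩))

lemma faithfulSMul_dual (haI : a ∈ I) (ha : a ∈ nonZeroDivisors R) :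
    FaithfulSMul R (Module.Dual R I) where
  eq_of_smul_eq_smul h := (mul_cancel_right_mem_nonZeroDivisors ha).1
    (LinearMap.congr_fun (h I.subtype) ⟨a, haI⟩)

lemma exists_smul_subtype_eq {f : Module.Dual R I}
    (hf : f ∈ I • (⊤ : Submodule R (Module.Dual R I))) :
    ∃ t ∈ trace R I, t • (I.subtype : Module.Dual R I) = f := by
  refine Submodule.smul_induction_on hf (fun x hx g _ ↦ ?_) fun f g hf hg ↦ ?_
  · exact ⟨g ⟨x, hx⟩, dual_apply_mem_trace g _, (smul_subtype_eq_apply_smul g ⟨x, hx⟩).symm⟩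
  · obtain ⟨s, hs, rfl⟩ := hf
    obtain ⟨t, ht, rfl⟩ := hg
    exact ⟨s + t, add_mem hs ht, add_smul ..⟩

lemma trace_eq_top_of_subtype_mem (haI : a ∈ I) (ha : a ∈ nonZeroDivisors R)
    (h : I.subtype ∈ I • (⊤ : Submodule R (Module.Dual R I))) : trace R I = ⊤ := by
  obtain ⟨t, ht, hsub⟩ := exists_smul_subtype_eq h
  have h1 : t = 1 := (mul_cancel_right_mem_nonZeroDivisors ha).1 <|
    (LinearMap.congr_fun hsub ⟨a, haI⟩).trans (one_mul a).symm
  exact (Ideal.eq_top_iff_one _).2 (h1 ▸ ht)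

lemma trace_eq_top_of_span_pair [Module.IsReflexive R I] (haI : a ∈ I) (ha : a ∈ nonZeroDivisors R)
    (hinj : Function.Injective (I.subtype.rTensor (Module.Dual R I)))
    (hfin : Module.length R (R ⧸ I) ≠ ⊤)
    {x y : I} (hxy : Submodule.span R {x, y} = ⊤) {c d : Module.Dual R I}
    (hcd : Submodule.span R {c, d} = ⊤) : trace R I = ⊤ := by
  have := faithfulSMul_of_mem haI ha
  have := faithfulSMul_dual haI ha
  have hrank (f : Module.Dual R I) (z w : I) : f z • w = f w • z :=
    Subtype.ext (by simpa [mul_comm] using mul_dual_apply f w z)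
  refine trace_eq_top_of_subtype_mem haI ha ?_
  rw [← comap_koszulDual_smul_top hrank hxy hcd hfin hinj, Submodule.mem_comap]
  have hrel : koszulDual x y I.subtype = (y : R) • (1, 0) + -(x : R) • (0, 1) := by
    simp [koszulDual]
  rw [hrel]
  exact add_mem (Submodule.smul_mem_smul y.2 trivial)
    (Submodule.smul_mem_smul (I.neg_mem x.2) trivial)

variable [IsNoetherianRing R]

lemma two_le_nu (hI : ¬ I.IsPrincipal) : 2 ≤ nu R I := by
  by_contra! h
  exact hI (isPrincipal_of_nu_le_one (IsNoetherian.noetherian I) (Nat.le_of_lt_succ h))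

lemma two_le_nu_dual [Module.IsReflexive R I] (haI : a ∈ I) (ha : a ∈ nonZeroDivisors R)
    (hI : ¬ I.IsPrincipal) : 2 ≤ nu R (Module.Dual R I) := by
  obtain ⟨K, h⟩ := exists_linked_of_isReflexive ha haI
  rw [nu_congr (h.dualEquiv ha)]
  exact two_le_nu fun hK ↦ hI (h.isPrincipal_left ha hK)

variable [IsLocalRing R]

lemma six_le_nu_mul_nu_dual [Module.IsReflexive R I] (haI : a ∈ I) (ha : a ∈ nonZeroDivisors R)
    (hinj : Function.Injective (I.subtype.rTensor (Module.Dual R I)))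
    (hfin : Module.length R (R ⧸ I) ≠ ⊤) (hI : ¬ I.IsPrincipal) :
    6 ≤ nu R I * nu R (Module.Dual R I) := by
  have := finite_dual haI ha
  have h2 := two_le_nu hI
  have h2' := two_le_nu_dual haI ha hI
  suffices ¬ (nu R I = 2 ∧ nu R (Module.Dual R I) = 2) by
    rcases (by omega : 3 ≤ nu R I ∨ 3 ≤ nu R (Module.Dual R I)) with h3 | h3 <;> nlinarith
  rintro ⟨hx, hc⟩
  obtain ⟨x, y, hxy⟩ := exists_span_pair_eq_top_of_nu_eq_two hx
  obtain ⟨c, d, hcd⟩ := exists_span_pair_eq_top_of_nu_eq_two hc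
  have htr := nu_trace hinj
  rw [trace_eq_top_of_span_pair haI ha hinj hfin hxy hcd, hx, hc] at htr
  have := nu_le_one_of_isPrincipal (top_isPrincipal (R := R))
  omega

end SixLe

section Content

variable {R : Type*} [CommRing R]

lemma mul_le_iff_le_colon {I K N : Ideal R} : I * K ≤ N ↔ K ≤ N.colon (I : Set R) := by
  rw [Ideal.mul_le, forall₂_comm]
  simp only [SetLike.le_def, Submodule.mem_colon, smul_eq_mul, mul_comm, SetLike.mem_coe]

lemma contentIdeal_le_iff {p : R[X]} {J : Ideal R} :
    p.contentIdeal ≤ J ↔ ∀ n, p.coeff n ∈ J := by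
  refine ⟨fun h n ↦ h (p.coeff_mem_contentIdeal n), fun h ↦ Ideal.span_le.2 fun x hx ↦ ?_⟩
  obtain ⟨n, -, rfl⟩ := mem_coeffs_iff.1 hx
  exact h n

lemma mem_map_C_iff_contentIdeal_le {p : R[X]} {J : Ideal R} :
    p ∈ J.map C ↔ p.contentIdeal ≤ J := by
  rw [Ideal.mem_map_C_iff, contentIdeal_le_iff]

lemma contentIdeal_mul_contentIdeal_le_iff {f p : R[X]} {J : Ideal R} :
    f.contentIdeal * p.contentIdeal ≤ J ↔ ∀ i t, f.coeff i * p.coeff t ∈ J := by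
  refine ⟨fun h i t ↦ h (Ideal.mul_mem_mul (f.coeff_mem_contentIdeal i)
    (p.coeff_mem_contentIdeal t)), fun h ↦ ?_⟩
  rw [contentIdeal_def, contentIdeal_def, Ideal.span_mul_span', Ideal.span_le]
  rintro _ ⟨x, hx, y, hy, rfl⟩
  obtain ⟨i, -, rfl⟩ := mem_coeffs_iff.1 hx
  obtain ⟨t, -, rfl⟩ := mem_coeffs_iff.1 hy
  exact h i t

lemma coeff_mul_leadingCoeff_mem {f p : R[X]} {J : Ideal R} {i : ℕ}
    (hfp : (f * p).coeff (i + p.natDegree) ∈ J)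
    (h : ∀ s > i, ∀ t, f.coeff s * p.coeff t ∈ J) : f.coeff i * p.leadingCoeff ∈ J := by
  classical
  have hmem : (i, p.natDegree) ∈ Finset.HasAntidiagonal.antidiagonal (i + p.natDegree) := by
    simp
  rw [coeff_mul, ← Finset.add_sum_erase _ _ hmem] at hfp
  refine (Ideal.add_mem_iff_left _ (Ideal.sum_mem _ ?_)).1 hfp
  rintro ⟨s, t⟩ hst
  obtain ⟨hne, hsum⟩ := Finset.mem_erase.1 hst
  rw [Finset.HasAntidiagonal.mem_antidiagonal] at hsum
  rcases lt_or_ge i s with hs | hs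
  · exact h s hs t
  · have ht : p.natDegree < t := by grind
    simp [coeff_eq_zero_of_natDegree_lt ht]

lemma contentIdeal_mul_C_mul_eraseLead_le {f p : R[X]} {M : Ideal R} {a : R}
    (hfp : ∀ n, a * (f * p).coeff n ∈ M) (hf : ∀ n, a * p.leadingCoeff * f.coeff n ∈ M) :
    (f * (C a * p.eraseLead)).contentIdeal ≤ M := by
  have h : f * (C a * p.eraseLead) =
      C a * (f * p) - X ^ p.natDegree * (C (a * p.leadingCoeff) * f) := by
    rw [C_mul]
    linear_combination C a * f * p.eraseLead_add_C_mul_X_pow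
  rw [← mem_map_C_iff_contentIdeal_le, h]
  refine sub_mem ?_ (Ideal.mul_mem_left _ _ ?_) <;>
    simpa only [Ideal.mem_map_C_iff, coeff_C_mul]

lemma contentIdeal_pow_succ_mul_le_of_le (f : R[X]) {d : ℕ} {p : R[X]} {N : Ideal R}
    (hp : p.natDegree ≤ d) (hN : f.contentIdeal ^ d * (f * p).contentIdeal ≤ N) :
    f.contentIdeal ^ (d + 1) * p.contentIdeal ≤ N := by
  induction d generalizing p with
  | zero =>
    obtain ⟨a, rfl⟩ := natDegree_eq_zero.1 (Nat.le_zero.1 hp)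
    rw [pow_zero, one_mul, contentIdeal_le_iff] at hN
    rw [pow_one, contentIdeal_mul_contentIdeal_le_iff]
    intro i t
    obtain rfl | ht := eq_or_ne t 0
    · simpa using hN i
    · simp [coeff_C_of_ne_zero ht]
  | succ d ih =>
    rw [pow_succ _ (d + 1), mul_assoc, mul_le_iff_le_colon, contentIdeal_mul_contentIdeal_le_iff]
    rw [mul_le_iff_le_colon, contentIdeal_le_iff] at hN
    refine Nat.strong_decreasing_induction ⟨f.natDegree, fun i hi t ↦ ?_⟩ fun i hi t ↦ ?_
    · simp [coeff_eq_zero_of_natDegree_lt hi]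
    have hlead := coeff_mul_leadingCoeff_mem (hN _) hi
    obtain rfl | ht := eq_or_ne t p.natDegree
    · exact hlead
    have hmem {z x : R} {n : ℕ} (hz : z ∈ f.contentIdeal ^ d)
        (hx : x ∈ N.colon (f.contentIdeal ^ (d + 1) : Ideal R)) : f.coeff n * x * z ∈ N := by
      rw [mul_assoc, mul_left_comm, mul_comm _ z]
      exact Submodule.mem_colon.1 hx _ (Ideal.mul_mem_mul hz (f.coeff_mem_contentIdeal n))
    have hq : f.contentIdeal ^ d * (f * (C (f.coeff i) * p.eraseLead)).contentIdeal ≤ N := by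
      refine mul_le_iff_le_colon.2 (contentIdeal_mul_C_mul_eraseLead_le ?_ ?_) <;>
        refine fun n ↦ Submodule.mem_colon.2 fun z hz ↦ ?_
      · exact hmem hz (hN n)
      · rw [mul_comm (_ * _)]
        exact hmem hz hlead
    have hdeg : (C (f.coeff i) * p.eraseLead).natDegree ≤ d := by
      have := natDegree_C_mul_le (f.coeff i) p.eraseLead
      have := p.eraseLead_natDegree_le
      omega
    have := contentIdeal_le_iff.1 (mul_le_iff_le_colon.1 (ih hdeg hq)) t
    rwa [coeff_C_mul, eraseLead_coeff_of_ne _ ht] at this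

/-- The Dedekind–Mertens lemma. -/
lemma contentIdeal_pow_succ_mul_le (f p : R[X]) :
    f.contentIdeal ^ (p.natDegree + 1) * p.contentIdeal ≤
      f.contentIdeal ^ p.natDegree * (f * p).contentIdeal :=
  contentIdeal_pow_succ_mul_le_of_le f le_rfl le_rfl

end Content

section Superficial

variable {R : Type*} [CommRing R] [IsNoetherianRing R]

/- In the associated graded ring: no nonzero element of large degree is annihilated by the
degree-one part. -/
lemma exists_le_pow_succ_of_mul_le (I : Ideal R) :
    ∃ n₀, ∀ n ≥ n₀, ∀ W ≤ I ^ n, I * W ≤ I ^ (n + 2) → W ≤ I ^ (n + 1) := by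
  let F : I.Filtration R :=
    { N := fun n ↦ I ^ n ⊓ (I ^ (n + 2)).colon (I : Set R)
      mono := fun n ↦ inf_le_inf (Ideal.pow_le_pow_right n.le_succ)
        (Submodule.colon_mono (Ideal.pow_le_pow_right (by omega)) subset_rfl)
      smul_le := fun n ↦ by
        have h : I * (I ^ n ⊓ (I ^ (n + 2)).colon (I : Set R)) ≤ I ^ (n + 2) :=
          mul_le_iff_le_colon.2 inf_le_right
        refine le_inf (h.trans (Ideal.pow_le_pow_right n.succ.le_succ)) (mul_le_iff_le_colon.1 ?_)
        exact (Ideal.mul_mono_right h).trans (pow_succ' I (n + 2)).ge }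
  have hF : F.Stable := (I.stableFiltration_stable (⊤ : Ideal R)).of_le fun n ↦
    inf_le_left.trans (by simp)
  obtain ⟨n₀, hn₀⟩ := hF
  refine ⟨n₀ + 1, fun n hn W hW hIW ↦ ?_⟩
  obtain ⟨k, rfl⟩ := Nat.exists_eq_succ_of_ne_zero (by omega : n ≠ 0)
  calc W ≤ F.N (k + 1) := le_inf hW (mul_le_iff_le_colon.1 hIW)
    _ = I * F.N k := (hn₀ k (by omega)).symm
    _ ≤ I ^ (k + 1 + 1) := mul_le_iff_le_colon.2 inf_le_right

lemma exists_le_pow_succ_of_pow_mul_le (I : Ideal R) :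
    ∃ n₀, ∀ n ≥ n₀, ∀ k, ∀ W ≤ I ^ n, I ^ k * W ≤ I ^ (n + k + 1) → W ≤ I ^ (n + 1) := by
  obtain ⟨n₀, hn₀⟩ := exists_le_pow_succ_of_mul_le I
  refine ⟨n₀, fun n hn k W hW hk ↦ ?_⟩
  induction k with
  | zero => simpa using hk
  | succ k ih =>
    refine ih (hn₀ (n + k) (by omega) _ ?_ ?_)
    · rw [add_comm, pow_add]
      exact Ideal.mul_mono_right hW
    · rwa [← mul_assoc, ← pow_succ']

lemma exists_mem_map_C_pow_succ_of_mul_mem (f : R[X]) :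
    ∃ n₀, ∀ n ≥ n₀, ∀ p ∈ (f.contentIdeal ^ n).map C,
      f * p ∈ (f.contentIdeal ^ (n + 2)).map C → p ∈ (f.contentIdeal ^ (n + 1)).map C := by
  obtain ⟨n₀, hn₀⟩ := exists_le_pow_succ_of_pow_mul_le f.contentIdeal
  refine ⟨n₀, fun n hn p hp hfp ↦ ?_⟩
  rw [mem_map_C_iff_contentIdeal_le] at hp hfp ⊢
  refine hn₀ n hn (p.natDegree + 1) _ hp ((contentIdeal_pow_succ_mul_le f p).trans ?_)
  refine (Ideal.mul_mono_right hfp).trans ?_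
  rw [← pow_add]
  exact Ideal.pow_le_pow_right (by omega)

lemma exists_contentIdeal_eq (I : Ideal R) : ∃ f : R[X], f.contentIdeal = I := by
  classical
  obtain ⟨n, x, hx⟩ := Submodule.fg_iff_exists_fin_generating_family.1 I.fg_of_isNoetherianRing
  refine ⟨ofFn n x, le_antisymm (contentIdeal_le_iff.2 fun i ↦ ?_) ?_⟩
  · rcases lt_or_ge i n with hi | hi
    · rw [ofFn_coeff_eq_val_of_lt _ hi, ← hx]
      exact Ideal.subset_span ⟨_, rfl⟩
    · rw [ofFn_coeff_eq_zero_of_ge _ hi]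
      exact zero_mem I
  · rw [← hx, Submodule.span_le]
    rintro _ ⟨i, rfl⟩
    rw [← ofFn_coeff_eq_val_of_lt x i.2]
    exact coeff_mem_contentIdeal _ _

end Superficial

section GenericExt

variable (R : Type u) [CommRing R] [IsLocalRing R]

instance isPrime_map_C_maximalIdeal : ((maximalIdeal R).map (C : R →+* R[X])).IsPrime :=
  Ideal.isPrime_map_C_of_isPrime

/-- The localization `R(X)` of `R[X]` at the extension of the maximal ideal of `R`: a flat local
extension of `R` with the same numerical invariants and an infinite residue field. -/
abbrev GenericExt : Type u := Localization.AtPrime ((maximalIdeal R).map (C : R →+* R[X]))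

lemma map_algebraMap_genericExt (N : Ideal R) :
    N.map (algebraMap R (GenericExt R)) = (N.map C).map (algebraMap R[X] (GenericExt R)) := by
  rw [Ideal.map_map, IsScalarTower.algebraMap_eq R R[X], algebraMap_eq]

lemma maximalIdeal_genericExt :
    maximalIdeal (GenericExt R) = (maximalIdeal R).map (algebraMap R (GenericExt R)) := by
  rw [map_algebraMap_genericExt, Localization.AtPrime.map_eq_maximalIdeal]

instance isNoetherianRing_genericExt [IsNoetherianRing R] : IsNoetherianRing (GenericExt R) :=
  IsLocalization.isNoetherianRing ((maximalIdeal R).map (C : R →+* R[X])).primeCompl _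
    inferInstance

instance flat_genericExt : Module.Flat R (GenericExt R) :=
  Module.Flat.trans R R[X] _

instance isLocalHom_algebraMap_genericExt : IsLocalHom (algebraMap R (GenericExt R)) :=
  ((local_hom_TFAE _).out 0 2).2 (maximalIdeal_genericExt R).ge

variable {R}

lemma mem_map_C_of_mul_mem {N : Ideal R} {s p : R[X]} (hs : s ∉ (maximalIdeal R).map C)
    (h : s * p ∈ N.map C) : p ∈ N.map C := by
  rw [mem_map_C_iff_contentIdeal_le] at h hs ⊢
  have htop : s.contentIdeal = ⊤ := by
    by_contra hne
    exact hs (le_maximalIdeal hne)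
  have hsp := contentIdeal_pow_succ_mul_le s p
  rw [htop, Ideal.top_pow, Ideal.top_pow, Ideal.top_mul, Ideal.top_mul] at hsp
  exact hsp.trans h

lemma algebraMap_mem_map_iff {N : Ideal R} {p : R[X]} :
    algebraMap R[X] (GenericExt R) p ∈ N.map (algebraMap R (GenericExt R)) ↔ p ∈ N.map C := by
  rw [map_algebraMap_genericExt, IsLocalization.algebraMap_mem_map_algebraMap_iff
    ((maximalIdeal R).map (C : R →+* R[X])).primeCompl]
  exact ⟨fun ⟨s, hs, h⟩ ↦ mem_map_C_of_mul_mem hs h, fun h ↦ ⟨1, one_mem _, by rwa [one_mul]⟩⟩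

lemma exists_isUnit_mul_eq_algebraMap (z : GenericExt R) :
    ∃ (u : GenericExt R) (p : R[X]), IsUnit u ∧ u * z = algebraMap _ _ p := by
  obtain ⟨⟨p, s⟩, h⟩ := IsLocalization.surj
    ((maximalIdeal R).map (C : R →+* R[X])).primeCompl z
  exact ⟨_, p, IsLocalization.map_units _ s, by rw [mul_comm]; exact h⟩

lemma algebraMap_dvd_algebraMap_iff {a : R} {p : R[X]} :
    algebraMap R (GenericExt R) a ∣ algebraMap _ _ p ↔ ∀ n, a ∣ p.coeff n := by
  rw [← Ideal.mem_span_singleton, ← Set.image_singleton, ← Ideal.map_span,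
    algebraMap_mem_map_iff, Ideal.mem_map_C_iff]
  simp only [Ideal.mem_span_singleton]

lemma mem_map_algebraMap_iff_forall_dvd_mul {a : R} {I K : Ideal R}
    (hK : ∀ {y}, y ∈ K ↔ ∀ x ∈ I, a ∣ y * x) {z : GenericExt R} :
    z ∈ K.map (algebraMap R (GenericExt R)) ↔
      ∀ w ∈ I.map (algebraMap R (GenericExt R)), algebraMap R (GenericExt R) a ∣ z * w := by
  constructor
  · intro hz w hw
    have hKI : K * I ≤ Ideal.span {a} := Ideal.mul_le.2 fun y hy x hx ↦
      Ideal.mem_span_singleton.2 (hK.1 hy x hx)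
    rw [← Ideal.mem_span_singleton, ← Set.image_singleton, ← Ideal.map_span]
    refine Ideal.map_mono hKI ?_
    rw [Ideal.map_mul]
    exact Ideal.mul_mem_mul hz hw
  · intro hz
    obtain ⟨u, p, hu, hup⟩ := exists_isUnit_mul_eq_algebraMap z
    rw [← Ideal.unit_mul_mem_iff_mem _ hu, hup, algebraMap_mem_map_iff, Ideal.mem_map_C_iff]
    refine fun n ↦ hK.2 fun x hx ↦ ?_
    have hdvd : algebraMap R (GenericExt R) a ∣ algebraMap _ _ (p * C x) := by
      rw [map_mul, ← hup, mul_assoc]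
      exact (hz _ (Ideal.mem_map_of_mem _ hx)).mul_left u
    simpa only [coeff_mul_C] using algebraMap_dvd_algebraMap_iff.1 hdvd n

lemma Linked.map_genericExt {a : R} {I K : Ideal R} (h : Linked a I K) :
    Linked (algebraMap R (GenericExt R) a) (I.map (algebraMap R (GenericExt R)))
      (K.map (algebraMap R (GenericExt R))) :=
  ⟨mem_map_algebraMap_iff_forall_dvd_mul h.mem_left_iff,
    mem_map_algebraMap_iff_forall_dvd_mul h.mem_right_iff⟩

lemma algebraMap_mem_nonZeroDivisors {a : R} (ha : a ∈ nonZeroDivisors R) :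
    algebraMap R (GenericExt R) a ∈ nonZeroDivisors (GenericExt R) := by
  rw [mem_nonZeroDivisors_iff_right]
  intro z hz
  have hreg := Module.Flat.isSMulRegular_of_nonZeroDivisors (M := GenericExt R) ha
  exact hreg.right_eq_zero_of_smul (by rw [Algebra.smul_def, mul_comm, hz])

end GenericExt

section Multiplication

variable {R : Type*} [CommRing R]

lemma span_singleton_mul_eq_map (x : R) (N : Ideal R) :
    Ideal.span {x} * N = Submodule.map (LinearMap.mulLeft R x) N :=
  Ideal.ext fun _ ↦ Ideal.mem_span_singleton_mul

lemma relLength_span_singleton_mul_le (x : R) (P Q : Ideal R) :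
    relLength (Ideal.span {x} * P) (Ideal.span {x} * Q) ≤ relLength P Q := by
  rw [span_singleton_mul_eq_map, span_singleton_mul_eq_map]
  exact relLength_map_le _ P Q

lemma relLength_span_singleton_mul {x : R} (hx : x ∈ nonZeroDivisors R) (P Q : Ideal R) :
    relLength (Ideal.span {x} * P) (Ideal.span {x} * Q) = relLength P Q := by
  rw [span_singleton_mul_eq_map, span_singleton_mul_eq_map]
  exact relLength_map P Q (mulLeft_injective_of_mem_nonZeroDivisors hx)

lemma relLength_top_add_relLength_span_singleton_mul (x : R) (N : Ideal R) :
    relLength ⊤ N + relLength N (Ideal.span {x} * N) =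
      relLength (Ideal.span {x} * ⊤) (Ideal.span {x} * N) + relLength ⊤ (Ideal.span {x}) := by
  rw [← relLength_eq_add le_top Ideal.mul_le_right, Ideal.mul_top, add_comm,
    ← relLength_eq_add le_top Ideal.mul_le_left]

lemma relLength_self_span_singleton_mul_le (x : R) {N : Ideal R} (hN : relLength ⊤ N ≠ ⊤) :
    relLength N (Ideal.span {x} * N) ≤ relLength ⊤ (Ideal.span {x}) := by
  rw [← ENat.add_le_add_iff_left hN, relLength_top_add_relLength_span_singleton_mul]
  gcongr
  exact relLength_span_singleton_mul_le x ⊤ N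

lemma relLength_self_span_singleton_mul {x : R} (hx : x ∈ nonZeroDivisors R) {N : Ideal R}
    (hN : relLength ⊤ N ≠ ⊤) :
    relLength N (Ideal.span {x} * N) = relLength ⊤ (Ideal.span {x}) := by
  refine ENat.add_right_injective_of_ne_top hN ?_
  simp only [relLength_top_add_relLength_span_singleton_mul, relLength_span_singleton_mul hx]

lemma relLength_top_ne_top_of_mem [IsNoetherianRing R] [Ring.KrullDimLE 1 R] {a : R} {N : Ideal R}
    (ha : a ∈ nonZeroDivisors R) (haN : a ∈ N) : relLength ⊤ N ≠ ⊤ := by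
  have h := isFiniteLength_quotient_span_singleton R ha
  rw [← Module.length_ne_top_iff, ← relLength_top] at h
  refine ne_top_of_le_ne_top h (relLength_le_of_inf_le (inf_le_right.trans ?_))
  exact (Ideal.span_singleton_le_iff_mem _).2 haN

lemma relLength_top_ne_top_iff [IsNoetherianRing R] {N : Ideal R} :
    relLength ⊤ N ≠ ⊤ ↔ IsArtinianRing (R ⧸ N) := by
  rw [relLength_top, Module.length_eq_of_surjective (S := R) (R := R ⧸ N)
    Ideal.Quotient.mk_surjective, Module.length_ne_top_iff,
    isFiniteLength_iff_isNoetherian_isArtinian]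
  exact and_iff_right inferInstance

variable [IsLocalRing R] [IsNoetherianRing R]

lemma nu_le_relLength_span_singleton {y : R} (hy : y ∈ maximalIdeal R) {N : Ideal R}
    (hN : relLength ⊤ N ≠ ⊤) : (nu R N : ℕ∞) ≤ relLength ⊤ (Ideal.span {y}) := by
  have hle : Ideal.span {y} * N ≤ maximalIdeal R * N :=
    Ideal.mul_mono_left ((Ideal.span_singleton_le_iff_mem _).2 hy)
  calc (nu R N : ℕ∞) = relLength N (maximalIdeal R * N) :=
        nu_eq_relLength (IsNoetherian.noetherian N)
    _ ≤ relLength N (Ideal.span {y} * N) := relLength_le_of_inf_le (inf_le_right.trans hle)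
    _ ≤ relLength ⊤ (Ideal.span {y}) := relLength_self_span_singleton_mul_le y hN

lemma nu_maximalIdeal_pow_eq_relLength (n : ℕ) :
    (nu R ((maximalIdeal R ^ n : Ideal R)) : ℕ∞) =
      relLength (maximalIdeal R ^ n) (maximalIdeal R ^ (n + 1)) := by
  rw [nu_eq_relLength (IsNoetherian.noetherian _), pow_succ', smul_eq_mul]

lemma relLength_top_maximalIdeal_pow (n : ℕ) :
    relLength ⊤ (maximalIdeal R ^ n) =
      ((∑ i ∈ Finset.range n, nu R (maximalIdeal R ^ i : Ideal R) : ℕ) : ℕ∞) := by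
  induction n with
  | zero => rw [relLength_eq_zero_iff.2] <;> simp
  | succ n ih =>
    rw [relLength_eq_add le_top (Ideal.pow_le_pow_right n.le_succ), ih, Finset.sum_range_succ,
      Nat.cast_add, nu_maximalIdeal_pow_eq_relLength]

lemma relLength_top_maximalIdeal_pow_ne_top (n : ℕ) : relLength ⊤ (maximalIdeal R ^ n) ≠ ⊤ :=
  relLength_top_maximalIdeal_pow (R := R) n ▸ ENat.natCast_ne_top _

lemma exists_mem_maximalIdeal_relLength_ne_top (hdim : ringKrullDim R = 1) :
    ∃ y ∈ maximalIdeal R, relLength ⊤ (Ideal.span {y}) ≠ ⊤ := by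
  obtain ⟨s, hs, hcard⟩ := Ideal.exists_finset_card_eq_height_of_isNoetherianRing (maximalIdeal R)
  have hheight := IsLocalRing.maximalIdeal_height_eq_ringKrullDim (R := R)
  rw [hdim, ← hcard] at hheight
  obtain ⟨y, rfl⟩ := Finset.card_eq_one.1 (by exact_mod_cast hheight : s.card = 1)
  rw [Finset.coe_singleton] at hs
  exact ⟨y, hs.1.2 (Ideal.mem_span_singleton_self y), relLength_top_ne_top_iff.2
    (IsLocalRing.quotient_artinian_of_mem_minimalPrimes_of_isLocalRing _ hs)⟩

lemma nu_maximalIdeal_pow_succ {f : R} (hf : f ∈ maximalIdeal R) {n : ℕ}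
    (hinj : ∀ z ∈ maximalIdeal R ^ n, f * z ∈ maximalIdeal R ^ (n + 2) →
      z ∈ maximalIdeal R ^ (n + 1)) :
    (nu R (maximalIdeal R ^ (n + 1) : Ideal R) : ℕ∞) = relLength (maximalIdeal R ^ (n + 1))
      (Ideal.span {f} * maximalIdeal R ^ n ⊔ maximalIdeal R ^ (n + 2)) +
        nu R (maximalIdeal R ^ n : Ideal R) := by
  have hfm : Ideal.span {f} ≤ maximalIdeal R := (Ideal.span_singleton_le_iff_mem _).2 hf
  have hmul (k : ℕ) : Ideal.span {f} * maximalIdeal R ^ k ≤ maximalIdeal R ^ (k + 1) :=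
    (Ideal.mul_mono_left hfm).trans_eq (pow_succ' _ _).symm
  have hle : maximalIdeal R ^ (n + 1) ≤
      Submodule.comap (LinearMap.mulLeft R f) (maximalIdeal R ^ (n + 2)) := by
    rw [← Submodule.map_le_iff_le_comap, ← span_singleton_mul_eq_map]
    exact hmul (n + 1)
  rw [nu_maximalIdeal_pow_eq_relLength, nu_maximalIdeal_pow_eq_relLength,
    relLength_eq_add (sup_le (hmul n) (Ideal.pow_le_pow_right (n + 1).le_succ)) le_sup_right,
    relLength_sup_right, span_singleton_mul_eq_map, relLength_map_left]
  congr 1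
  exact le_antisymm (relLength_le_of_inf_le (inf_le_right.trans hle))
    (relLength_le_of_inf_le fun z hz ↦ hinj z hz.1 hz.2)

lemma span_singleton_mul_eq_pow_succ {f : R} (hf : f ∈ maximalIdeal R) {n : ℕ}
    (h : maximalIdeal R ^ (n + 1) ≤
      Ideal.span {f} * maximalIdeal R ^ n ⊔ maximalIdeal R ^ (n + 2)) :
    Ideal.span {f} * maximalIdeal R ^ n = maximalIdeal R ^ (n + 1) := by
  apply le_antisymm
  · rw [pow_succ']
    exact Ideal.mul_mono_left ((Ideal.span_singleton_le_iff_mem _).2 hf)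
  · refine Submodule.le_of_le_smul_of_le_jacobson_bot (I := maximalIdeal R)
      (IsNoetherian.noetherian _) (maximalIdeal_le_jacobson _) ?_
    rwa [smul_eq_mul, ← pow_succ']

end Multiplication

section Multiplicity

variable {R : Type u} [CommRing R] [IsLocalRing R] [IsNoetherianRing R]

lemma nu_maximalIdeal_genericExt_pow (n : ℕ) :
    nu (GenericExt R) (maximalIdeal (GenericExt R) ^ n : Ideal (GenericExt R)) =
      nu R (maximalIdeal R ^ n : Ideal R) := by
  rw [maximalIdeal_genericExt, ← Ideal.map_pow, nu_map_of_flat _ (IsNoetherian.noetherian _)]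

variable (R) in
lemma exists_superficial_genericExt :
    ∃ f ∈ maximalIdeal (GenericExt R), ∃ n₀, ∀ n ≥ n₀, ∀ z ∈ maximalIdeal (GenericExt R) ^ n,
      f * z ∈ maximalIdeal (GenericExt R) ^ (n + 2) →
        z ∈ maximalIdeal (GenericExt R) ^ (n + 1) := by
  obtain ⟨g, hg⟩ := exists_contentIdeal_eq (maximalIdeal R)
  obtain ⟨n₀, hn₀⟩ := exists_mem_map_C_pow_succ_of_mul_mem g
  have hpow (n : ℕ) : maximalIdeal (GenericExt R) ^ n =
      (maximalIdeal R ^ n).map (algebraMap R (GenericExt R)) := by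
    rw [maximalIdeal_genericExt, Ideal.map_pow]
  refine ⟨algebraMap _ _ g, ?_, n₀, fun n hn z hz hgz ↦ ?_⟩
  · rw [maximalIdeal_genericExt, algebraMap_mem_map_iff, mem_map_C_iff_contentIdeal_le, hg]
  · obtain ⟨u, p, hu, hup⟩ := exists_isUnit_mul_eq_algebraMap z
    rw [← Ideal.unit_mul_mem_iff_mem _ hu, mul_left_comm, hup, ← map_mul, hpow,
      algebraMap_mem_map_iff] at hgz
    rw [← Ideal.unit_mul_mem_iff_mem _ hu, hup, hpow, algebraMap_mem_map_iff] at hz ⊢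
    rw [hg] at hn₀
    exact hn₀ n hn p hz hgz

lemma exists_nu_maximalIdeal_pow_le (hdim : ringKrullDim R = 1) :
    ∃ B, ∀ n, nu R (maximalIdeal R ^ n : Ideal R) ≤ B := by
  obtain ⟨y, hy, hfin⟩ := exists_mem_maximalIdeal_relLength_ne_top hdim
  obtain ⟨B, hB⟩ := ENat.ne_top_iff_exists.1 hfin
  refine ⟨B, fun n ↦ ?_⟩
  have h := nu_le_relLength_span_singleton hy (relLength_top_maximalIdeal_pow_ne_top n)
  rwa [← hB, Nat.cast_le] at h

lemma eventually_eq_of_le_succ_of_le {v : ℕ → ℕ} {n₀ B : ℕ} (hv : ∀ n ≥ n₀, v n ≤ v (n + 1))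
    (hB : ∀ n, v n ≤ B) : ∃ e, ∀ᶠ n in atTop, v n = e := by
  have hmono : Monotone fun n ↦ v (n + n₀) := monotone_nat_of_le_succ fun n ↦ by
    simpa only [add_right_comm] using hv (n + n₀) le_add_self
  have hbdd : BddAbove (Set.range fun n ↦ v (n + n₀)) := ⟨B, by rintro _ ⟨n, rfl⟩; exact hB _⟩
  have h := tendsto_atTop_ciSup hmono hbdd
  rw [nhds_discrete, tendsto_pure] at h
  refine ⟨⨆ n, v (n + n₀), ?_⟩
  rwa [← map_add_atTop_eq_nat n₀, eventually_map]

lemma nu_maximalIdeal_pow_ne_zero (hdim : ringKrullDim R ≠ 0) (n : ℕ) :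
    nu R (maximalIdeal R ^ n : Ideal R) ≠ 0 := by
  rw [nu_submodule, Ne, Submodule.spanFinrank_eq_zero_iff_eq_bot (IsNoetherian.noetherian _)]
  intro hn
  have hR : Ring.KrullDimLE 0 R := Ring.krullDimLE_zero_iff.2 fun p hp ↦ by
    have hle : maximalIdeal R ≤ p := hp.le_of_pow_le (n := n) (hn.le.trans bot_le)
    rw [← (maximalIdeal.isMaximal R).eq_of_le hp.ne_top hle]
    infer_instance
  exact hdim (ringKrullDimZero_iff_ringKrullDim_eq_zero.1 hR)

lemma exists_span_singleton_mul_eq_pow_succ {e : ℕ}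
    (he : ∀ᶠ n in atTop, nu R (maximalIdeal R ^ n : Ideal R) = e) :
    ∃ f ∈ maximalIdeal (GenericExt R), ∃ n, nu R (maximalIdeal R ^ n : Ideal R) = e ∧
      Ideal.span {f} * maximalIdeal (GenericExt R) ^ n = maximalIdeal (GenericExt R) ^ (n + 1) := by
  obtain ⟨f, hfm, n₀, hf⟩ := exists_superficial_genericExt R
  obtain ⟨n, ⟨hne, hne'⟩, hn⟩ :=
    ((he.and ((tendsto_add_atTop_nat 1).eventually he)).and (eventually_ge_atTop n₀)).exists
  refine ⟨f, hfm, n, hne, span_singleton_mul_eq_pow_succ hfm (relLength_eq_zero_iff.1 ?_)⟩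
  have h := nu_maximalIdeal_pow_succ hfm (hf n hn)
  simp only [nu_maximalIdeal_genericExt_pow, hne, hne'] at h
  exact (ENat.add_left_injective_of_ne_top (ENat.natCast_ne_top e) (by simpa using h)).symm

lemma exists_eventually_nu_maximalIdeal_pow_eq (hdim : ringKrullDim R = 1) :
    ∃ e, ∀ᶠ n in atTop, nu R (maximalIdeal R ^ n : Ideal R) = e := by
  obtain ⟨f, hfm, n₀, hf⟩ := exists_superficial_genericExt R
  obtain ⟨B, hB⟩ := exists_nu_maximalIdeal_pow_le hdim
  refine eventually_eq_of_le_succ_of_le (n₀ := n₀) (fun n hn ↦ Nat.cast_le (α := ℕ∞).1 ?_) hB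
  have h := nu_maximalIdeal_pow_succ hfm (hf n hn)
  rw [nu_maximalIdeal_genericExt_pow, nu_maximalIdeal_genericExt_pow] at h
  exact le_add_self.trans h.ge

lemma tendsto_normalizedLength (hdim : ringKrullDim R = 1) {e : ℕ}
    (he : ∀ᶠ n in atTop, nu R (maximalIdeal R ^ n : Ideal R) = e) :
    Tendsto (normalizedLength R) atTop (nhds (e : ℝ)) := by
  have h : Tendsto (fun n ↦ (nu R (maximalIdeal R ^ n : Ideal R) : ℝ)) atTop (nhds (e : ℝ)) :=
    tendsto_const_nhds.congr' (he.mono fun n hn ↦ by simp only [hn])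
  refine h.cesaro.congr fun n ↦ ?_
  have hd : ((ringKrullDim R).unbotD 0).toNat = 1 := by rw [hdim]; rfl
  rw [normalizedLength, hd, ← relLength_top, relLength_top_maximalIdeal_pow, ENat.toNat_natCast]
  push_cast
  simp [div_eq_inv_mul]

lemma mult_eq (hdim : ringKrullDim R = 1) {e : ℕ}
    (he : ∀ᶠ n in atTop, nu R (maximalIdeal R ^ n : Ideal R) = e) : mult R = e :=
  (tendsto_normalizedLength hdim he).limUnder_eq

lemma tendsto_normalizedLength_mult (hdim : ringKrullDim R = 1) :
    Tendsto (normalizedLength R) atTop (nhds (mult R)) := by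
  obtain ⟨e, he⟩ := exists_eventually_nu_maximalIdeal_pow_eq hdim
  exact mult_eq hdim he ▸ tendsto_normalizedLength hdim he

lemma one_le_mult (hdim : ringKrullDim R = 1) : 1 ≤ mult R := by
  obtain ⟨e, he⟩ := exists_eventually_nu_maximalIdeal_pow_eq hdim
  obtain ⟨n, hn⟩ := he.exists
  have hpos := Nat.one_le_iff_ne_zero.2 (nu_maximalIdeal_pow_ne_zero (R := R) (by simp [hdim]) n)
  rw [mult_eq hdim he, ← hn]
  exact_mod_cast hpos

end Multiplicity

section KeyInequality

variable {R : Type*} [CommRing R] {a x : R} {I K J : Ideal R}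

lemma Linked.mem_span_singleton_mul (h : Linked a I K) (ha : a ∈ nonZeroDivisors R)
    (hx : x ∈ nonZeroDivisors R) {k : R} (hk : ∀ i ∈ I, a * x ∣ i * k) :
    k ∈ Ideal.span {x} * K := by
  obtain ⟨w, hw⟩ := hk a h.mem_left
  obtain rfl : k = x * w := (mul_cancel_left_mem_nonZeroDivisors ha).1 (by rw [hw, mul_assoc])
  refine Ideal.mul_mem_mul (Ideal.mem_span_singleton_self x) (h.mem_right_iff.2 fun i hi ↦ ?_)
  obtain ⟨v, hv⟩ := hk i hi
  exact ⟨v, (mul_cancel_left_mem_nonZeroDivisors hx).1 (by linear_combination hv)⟩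

lemma Linked.relLength_le (h : Linked a I K) (ha : a ∈ nonZeroDivisors R)
    (hx : x ∈ nonZeroDivisors R) (hI : I.FG) (hJ : I * K ≤ Ideal.span {a} * J) (P : Ideal R) :
    relLength (P * K) (Ideal.span {x} * K) ≤
      nu R I * relLength (P * J) (Ideal.span {x} * J) := by
  obtain ⟨s, hs, hsI⟩ := Submodule.FG.exists_span_finset_card_eq_spanFinrank hI
  rw [nu_submodule, ← hs, ← Fintype.card_coe,
    ← relLength_span_singleton_mul ha (P * J)]
  refine relLength_le_card_mul (fun g : s ↦ LinearMap.mulLeft R (g : R)) (fun g ↦ ?_) ?_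
  · have hg : Ideal.span {(g : R)} ≤ I :=
      (Ideal.span_singleton_le_iff_mem _).2 (hsI ▸ Submodule.subset_span g.2)
    calc Submodule.map (LinearMap.mulLeft R (g : R)) (P * K)
      _ = P * (Ideal.span {(g : R)} * K) := by rw [← span_singleton_mul_eq_map, mul_left_comm]
      _ ≤ P * (Ideal.span {a} * J) := Ideal.mul_mono_right ((Ideal.mul_mono_left hg).trans hJ)
      _ = Ideal.span {a} * (P * J) := mul_left_comm ..
  · rintro k ⟨-, hk⟩
    have hsk : I ≤ (Ideal.span {a * x}).colon {k} := by
      rw [← hsI, Submodule.span_le]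
      intro g hg
      have hgk : g * k ∈ Ideal.span {a} * (Ideal.span {x} * J) :=
        (Submodule.mem_iInf _).1 hk ⟨g, hg⟩
      rw [← mul_assoc, Ideal.span_singleton_mul_span_singleton] at hgk
      exact Submodule.mem_colon_singleton.2 (Ideal.mul_le_left hgk)
    exact h.mem_span_singleton_mul ha hx fun i hi ↦
      Ideal.mem_span_singleton.1 (Submodule.mem_colon_singleton.1 (hsk hi))

variable [IsLocalRing R]

lemma mem_nonZeroDivisors_of_span_singleton_mul_eq (ha : a ∈ nonZeroDivisors R)
    (ham : a ∈ maximalIdeal R) {n : ℕ}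
    (h : Ideal.span {x} * maximalIdeal R ^ n = maximalIdeal R ^ (n + 1)) :
    x ∈ nonZeroDivisors R := by
  obtain ⟨z, -, hz⟩ := Ideal.mem_span_singleton_mul.1 (h.ge (Ideal.pow_mem_pow ham (n + 1)))
  exact (mul_mem_nonZeroDivisors.1 (hz ▸ pow_mem ha (n + 1) : x * z ∈ nonZeroDivisors R)).1

variable [IsNoetherianRing R]

lemma relLength_self_span_singleton_mul_eq_nu_add (hx : x ∈ maximalIdeal R) (N : Ideal R) :
    relLength N (Ideal.span {x} * N) =
      nu R N + relLength (maximalIdeal R * N) (Ideal.span {x} * N) := by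
  rw [nu_eq_relLength (IsNoetherian.noetherian N)]
  exact relLength_eq_add Ideal.mul_le_right
    (Ideal.mul_mono_left ((Ideal.span_singleton_le_iff_mem _).2 hx))

lemma Linked.relLength_add_nu_mul_nu_le (h : Linked a I K) (ha : a ∈ nonZeroDivisors R)
    (hx : x ∈ nonZeroDivisors R) (hxm : x ∈ maximalIdeal R) (hJ : I * K ≤ Ideal.span {a} * J) :
    relLength K (Ideal.span {x} * K) + nu R I * nu R J ≤
      nu R K + nu R I * relLength J (Ideal.span {x} * J) := by
  rw [relLength_self_span_singleton_mul_eq_nu_add hxm,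
    relLength_self_span_singleton_mul_eq_nu_add hxm, mul_add, add_assoc, add_comm (relLength _ _)]
  gcongr
  exact h.relLength_le ha hx (IsNoetherian.noetherian I) hJ _

end KeyInequality

section GenericKeyInequality

variable {R : Type u} [CommRing R] [IsLocalRing R] [IsNoetherianRing R] {a : R} {I K J : Ideal R}

lemma relLength_top_map_genericExt_ne_top {N : Ideal R} (hN : relLength ⊤ N ≠ ⊤) :
    relLength ⊤ (N.map (algebraMap R (GenericExt R))) ≠ ⊤ := by
  have := relLength_top_ne_top_iff.1 hN
  obtain ⟨k, hk⟩ := exists_maximalIdeal_pow_le_of_isArtinianRing_quotient N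
  refine ne_top_of_le_ne_top (relLength_top_maximalIdeal_pow_ne_top (R := GenericExt R) k)
    (relLength_le_of_inf_le (inf_le_right.trans ?_))
  rw [maximalIdeal_genericExt, ← Ideal.map_pow]
  exact Ideal.map_mono hk

lemma exists_relLength_self_span_singleton_mul_eq {e : ℕ}
    (he : ∀ᶠ n in atTop, nu R (maximalIdeal R ^ n : Ideal R) = e) (ha : a ∈ nonZeroDivisors R)
    (ham : a ∈ maximalIdeal R) :
    ∃ f ∈ maximalIdeal (GenericExt R), f ∈ nonZeroDivisors (GenericExt R) ∧
      ∀ N : Ideal (GenericExt R), relLength ⊤ N ≠ ⊤ → relLength N (Ideal.span {f} * N) = e := by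
  obtain ⟨f, hfm, n, hne, hf⟩ := exists_span_singleton_mul_eq_pow_succ he
  have hfreg := mem_nonZeroDivisors_of_span_singleton_mul_eq (algebraMap_mem_nonZeroDivisors ha)
    (maximalIdeal_genericExt R ▸ Ideal.mem_map_of_mem _ ham) hf
  refine ⟨f, hfm, hfreg, fun N hN ↦ ?_⟩
  rw [relLength_self_span_singleton_mul hfreg hN, ← relLength_self_span_singleton_mul hfreg
    (relLength_top_maximalIdeal_pow_ne_top n), hf, ← nu_maximalIdeal_pow_eq_relLength,
    nu_maximalIdeal_genericExt_pow, hne]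

lemma Linked.add_nu_mul_nu_le (h : Linked a I K) (ha : a ∈ nonZeroDivisors R)
    (ham : a ∈ maximalIdeal R) {e : ℕ}
    (he : ∀ᶠ n in atTop, nu R (maximalIdeal R ^ n : Ideal R) = e)
    (hIK : I * K ≤ Ideal.span {a} * J) (hK : relLength ⊤ K ≠ ⊤) (hJ : relLength ⊤ J ≠ ⊤) :
    e + nu R I * nu R J ≤ nu R K + nu R I * e := by
  obtain ⟨f, hfm, hfreg, hfe⟩ := exists_relLength_self_span_singleton_mul_eq he ha ham
  have hIK' := Ideal.map_mono (f := algebraMap R (GenericExt R)) hIK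
  rw [Ideal.map_mul, Ideal.map_mul, Ideal.map_span, Set.image_singleton] at hIK'
  have hle := h.map_genericExt.relLength_add_nu_mul_nu_le (algebraMap_mem_nonZeroDivisors ha)
    hfreg hfm hIK'
  simp only [nu_map_of_flat _ (IsNoetherian.noetherian _),
    hfe _ (relLength_top_map_genericExt_ne_top hK),
    hfe _ (relLength_top_map_genericExt_ne_top hJ)] at hle
  exact_mod_cast hle

end GenericKeyInequality

section Delta

lemma krullDimLE_one {R : Type*} [CommRing R] (hdim : ringKrullDim R = 1) :
    Ring.KrullDimLE 1 R :=
  Ring.krullDimLE_iff.2 hdim.le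

lemma le_of_le_add_mul_of_mul_le {p q e δ : ℝ} (hp : 1 < p) (h : e ≤ q + p * δ)
    (hpq : p * q ≤ e - δ) : q ≤ δ :=
  le_of_mul_le_mul_left (by linarith : (p - 1) * q ≤ (p - 1) * δ) (sub_pos.2 hp)

lemma sub_le_sq {p q e δ : ℝ} (hp : p ≤ δ) (hq : q ≤ δ) (hδ : 0 ≤ δ) (h : e ≤ q + p * δ) :
    e - δ ≤ δ ^ 2 := by
  linarith [mul_le_mul_of_nonneg_right hp hδ]

lemma sq_eq_sub_iff {p q e δ : ℝ} (hp : 1 < p) (hq : 1 < q) (h₁ : e ≤ q + p * δ)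
    (h₂ : e ≤ p + q * δ) (hpq : p * q ≤ e - δ) : δ ^ 2 = e - δ ↔ δ = p ∧ δ = q := by
  have hqδ : q ≤ δ := le_of_le_add_mul_of_mul_le hp h₁ hpq
  have hpδ : p ≤ δ := le_of_le_add_mul_of_mul_le hq h₂ (mul_comm p q ▸ hpq)
  have hδ : 0 < δ := by linarith
  constructor
  · intro h
    exact ⟨le_antisymm (le_of_mul_le_mul_right (by linarith : δ * δ ≤ p * δ) hδ) hpδ,
      le_antisymm (le_of_mul_le_mul_right (by linarith : δ * δ ≤ q * δ) hδ) hqδ⟩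
  · rintro ⟨rfl, rfl⟩
    linarith

variable {R : Type u} [CommRing R] {a : R} {I : Ideal R}

lemma trace_eq_top_of_isPrincipal (ha : a ∈ nonZeroDivisors R) (haI : a ∈ I)
    (hI : I.IsPrincipal) : trace R I = ⊤ := by
  obtain ⟨b, rfl⟩ := hI
  have hb : b ∈ nonZeroDivisors R := by
    obtain ⟨c, rfl⟩ := Ideal.mem_span_singleton.1 haI
    exact (mul_mem_nonZeroDivisors.1 ha).1
  obtain ⟨f, hf⟩ := exists_smul_eq_of_forall_dvd hb (R ∙ b).subtype
    fun x ↦ Ideal.mem_span_singleton.1 x.2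
  have hfb : f ⟨b, Submodule.mem_span_singleton_self b⟩ = 1 :=
    (mul_cancel_left_mem_nonZeroDivisors hb).1 ((LinearMap.congr_fun hf _).trans (mul_one b).symm)
  exact (Ideal.eq_top_iff_one _).2 (hfb ▸ dual_apply_mem_trace f _)

variable [IsLocalRing R]

lemma nu_top : nu R (⊤ : Ideal R) = 1 := by
  refine le_antisymm (nu_le_one_of_isPrincipal top_isPrincipal) (Nat.one_le_iff_ne_zero.2 ?_)
  rw [nu_submodule, Ne, Submodule.spanFinrank_eq_zero_iff_eq_bot (Ideal.fg_top R)]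
  exact top_ne_bot

lemma delta_of_trace_eq_top (h : trace R I = ⊤) : delta I = mult R - 1 := by
  have hset : nuAboveTrace I = {1} := by
    ext n
    simp [nuAboveTrace, h, nu_top, eq_comm]
  rw [delta, hset, csSup_singleton, Nat.cast_one]

variable [IsNoetherianRing R]

lemma isGreatest_nuAboveTrace (hdim : ringKrullDim R = 1) (ha : a ∈ nonZeroDivisors R)
    (haI : a ∈ I) : IsGreatest (nuAboveTrace I) (sSup (nuAboveTrace I)) := by
  have := krullDimLE_one hdim
  obtain ⟨y, hy, hfin⟩ := exists_mem_maximalIdeal_relLength_ne_top hdim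
  obtain ⟨B, hB⟩ := ENat.ne_top_iff_exists.1 hfin
  have hbdd : BddAbove (nuAboveTrace I) := by
    refine ⟨B, ?_⟩
    rintro _ ⟨J, hJ, rfl⟩
    have hle := nu_le_relLength_span_singleton hy
      (relLength_top_ne_top_of_mem ha (hJ (le_trace haI)))
    rwa [← hB, Nat.cast_le] at hle
  exact ⟨Nat.sSup_mem ⟨_, trace R I, le_rfl, rfl⟩ hbdd, fun n hn ↦ le_csSup hbdd hn⟩

lemma Linked.mult_le {K J : Ideal R} (h : Linked a I K) (hdim : ringKrullDim R = 1)
    (ha : a ∈ nonZeroDivisors R) (ham : a ∈ maximalIdeal R) (haJ : a ∈ J)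
    (hIK : I * K ≤ Ideal.span {a} * J) :
    mult R ≤ nu R K + nu R I * (mult R - nu R J) := by
  have := krullDimLE_one hdim
  obtain ⟨e, he⟩ := exists_eventually_nu_maximalIdeal_pow_eq hdim
  have hle := h.add_nu_mul_nu_le ha ham he hIK (relLength_top_ne_top_of_mem ha h.symm.mem_left)
    (relLength_top_ne_top_of_mem ha haJ)
  have hle' : (e + nu R I * nu R J : ℝ) ≤ nu R K + nu R I * e := by exact_mod_cast hle
  rw [mult_eq hdim he]
  linarith

lemma mult_le_add_mul_delta [Module.IsReflexive R I] (hdim : ringKrullDim R = 1)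
    (ha : a ∈ nonZeroDivisors R) (haI : a ∈ I) (hI : I ≠ ⊤) :
    mult R ≤ nu R (Module.Dual R I) + nu R I * delta I ∧
      mult R ≤ nu R I + nu R (Module.Dual R I) * delta I := by
  obtain ⟨K, h⟩ := exists_linked_of_isReflexive ha haI
  obtain ⟨J, hJ, hJmax⟩ := (isGreatest_nuAboveTrace hdim ha haI).1
  have ham := le_maximalIdeal hI haI
  have haJ := hJ (le_trace haI)
  have hIK : I * K ≤ Ideal.span {a} * J := (h.mul_le ha).trans (Ideal.mul_mono_right hJ)
  rw [delta, ← hJmax, nu_congr (h.dualEquiv ha)]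
  exact ⟨h.mult_le hdim ha ham haJ hIK, h.symm.mult_le hdim ha ham haJ (mul_comm I K ▸ hIK)⟩

lemma nu_mul_nu_dual_le_mult_sub_delta (hdim : ringKrullDim R = 1)
    (ha : a ∈ nonZeroDivisors R) (haI : a ∈ I)
    (hinj : Function.Injective (I.subtype.rTensor (Module.Dual R I))) :
    (nu R I * nu R (Module.Dual R I) : ℝ) ≤ mult R - delta I := by
  have := finite_dual haI ha
  have hle := (isGreatest_nuAboveTrace hdim ha haI).2 ⟨trace R I, le_rfl, nu_trace hinj⟩
  rw [delta, sub_sub_cancel]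
  exact_mod_cast hle

lemma delta_sq_eq_iff_of_isPrincipal (hdim : ringKrullDim R = 1)
    (ha : a ∈ nonZeroDivisors R) (haI : a ∈ I)
    (hinj : Function.Injective (I.subtype.rTensor (Module.Dual R I))) (hI : I.IsPrincipal) :
    delta I ^ 2 = mult R - delta I ↔
      delta I = nu R I ∧ delta I = nu R (Module.Dual R I) := by
  have := finite_dual haI ha
  have htop := trace_eq_top_of_isPrincipal ha haI hI
  have hnu := nu_trace hinj
  rw [htop, nu_top, eq_comm, mul_eq_one] at hnu
  have hmult := one_le_mult hdim
  rw [hnu.1, hnu.2, delta_of_trace_eq_top htop, Nat.cast_one, and_self, sub_sub_cancel,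
    pow_eq_one_iff_of_nonneg (sub_nonneg.2 hmult) two_ne_zero]

end Delta

end OneDimGor

open OneDimGor in
theorem proposition4p4_general {R : Type*} [CommRing R] [IsNoetherianRing R] [IsLocalRing R]
    (hdim : ringKrullDim R = 1) (I : Ideal R) [Module.IsReflexive R I]
    (hreg : ∃ x ∈ I, x ∈ nonZeroDivisors R)
    (htf : Module.IsTorsionFree R (I ⊗[R] Module.Dual R I)) :
    Filter.Tendsto (normalizedLength R) Filter.atTop (nhds (mult R)) ∧
    IsGreatest (nuAboveTrace I) (sSup (nuAboveTrace I)) ∧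
    (¬ Submodule.IsPrincipal I →
      ((nu R I : ℝ) ≤ delta I ∧ (nu R (Module.Dual R I) : ℝ) ≤ delta I) ∧
      (mult R - nu R (Module.Dual R I)) * (nu R I : ℝ)⁻¹ ≤ delta I ∧
      (mult R - delta I ≤ delta I ^ 2 ∧
        (nu R I : ℝ) * nu R (Module.Dual R I) ≤ mult R - delta I ∧
        6 ≤ nu R I * nu R (Module.Dual R I))) ∧
    (delta I ^ 2 = mult R - delta I ↔
      delta I = nu R I ∧ delta I = nu R (Module.Dual R I)) := by
  obtain ⟨a, haI, ha⟩ := hreg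
  have := krullDimLE_one hdim
  have hinj := rTensor_subtype_injective haI ha htf
  have hlim := tendsto_normalizedLength_mult hdim
  have hmax := isGreatest_nuAboveTrace hdim ha haI
  by_cases hI : Submodule.IsPrincipal I
  · exact ⟨hlim, hmax, fun h ↦ absurd hI h,
      delta_sq_eq_iff_of_isPrincipal hdim ha haI hinj hI⟩
  have hp : (1 : ℝ) < nu R I := Nat.one_lt_cast.2 (two_le_nu hI)
  have hq : (1 : ℝ) < nu R (Module.Dual R I) :=
    Nat.one_lt_cast.2 (two_le_nu_dual haI ha hI)
  have hpq := nu_mul_nu_dual_le_mult_sub_delta hdim ha haI hinj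
  obtain ⟨h₁, h₂⟩ := mult_le_add_mul_delta hdim ha haI fun h ↦ hI (h ▸ top_isPrincipal)
  have hqδ := le_of_le_add_mul_of_mul_le hp h₁ hpq
  have hpδ := le_of_le_add_mul_of_mul_le hq h₂ (mul_comm (nu R I : ℝ) _ ▸ hpq)
  have hfin := relLength_top I ▸ relLength_top_ne_top_of_mem ha haI
  refine ⟨hlim, hmax, fun _ ↦ ⟨⟨hpδ, hqδ⟩, ?_,
    sub_le_sq hpδ hqδ (by linarith) h₁, hpq,
    six_le_nu_mul_nu_dual haI ha hinj hfin hI⟩, sq_eq_sub_iff hp hq h₁ h₂ hpq⟩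
  rw [← div_eq_mul_inv, div_le_iff₀ (by linarith)]
  linarith

theorem proposition4p4 {R : Type*} [CommRing R] [IsNoetherianRing R] [IsLocalRing R]
    (hGor : OneDimGor.IsGorenstein R) (hdim : ringKrullDim R = 1)
    (I : Ideal R) (hreg : ∃ x ∈ I, x ∈ nonZeroDivisors R)
    (htf : Module.IsTorsionFree R (I ⊗[R] Module.Dual R I)) :
    -- the multiplicity and the maximum in the definition of `δ` are well defined
    Filter.Tendsto (OneDimGor.normalizedLength R) Filter.atTop (nhds (OneDimGor.mult R)) ∧
    IsGreatest (OneDimGor.nuAboveTrace I) (sSup (OneDimGor.nuAboveTrace I)) ∧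
    (¬ Submodule.IsPrincipal I →
      ((OneDimGor.nu R I : ℝ) ≤ OneDimGor.delta I ∧
        (OneDimGor.nu R (Module.Dual R I) : ℝ) ≤ OneDimGor.delta I) ∧
      (OneDimGor.mult R - OneDimGor.nu R (Module.Dual R I)) * (OneDimGor.nu R I : ℝ)⁻¹
        ≤ OneDimGor.delta I ∧
      (OneDimGor.mult R - OneDimGor.delta I ≤ OneDimGor.delta I ^ 2 ∧
        (OneDimGor.nu R I : ℝ) * OneDimGor.nu R (Module.Dual R I)
          ≤ OneDimGor.mult R - OneDimGor.delta I ∧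
        6 ≤ OneDimGor.nu R I * OneDimGor.nu R (Module.Dual R I))) ∧
    (OneDimGor.delta I ^ 2 = OneDimGor.mult R - OneDimGor.delta I ↔
      OneDimGor.delta I = OneDimGor.nu R I ∧
        OneDimGor.delta I = OneDimGor.nu R (Module.Dual R I)) :=
  have := OneDimGor.krullDimLE_one hdim
  have := hGor.isReflexive hreg
  proposition4p4_general hdim I hreg htf
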